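/- Let $\overline{\mathbb C}=\mathbb C\cup\{\infty\}$ be the Riemann sphere and $d^\#$ the spherical distance on it (the geodesic distance of $|dz|/(1+|z|^2)$). A *hyperbolic domain* is a connected open non-empty set $V\subset\overline{\mathbb C}$ whose complement contains at least three points; for a hyperbolic domain $V\subset\mathbb C$ let $\rho_V$ be its hyperbolic distance. A sequence of pointed domains $(U_m,u_m)$ *converges in the Carathéodory topology* to $(V,v)$, where $v\in V$ and either $V\subset\overline{\mathbb C}$ is a domain or $V=\{v\}$, if (i) $u_m\to v$ in $\overline{\mathbb C}$; (ii) if $V\neq\{v\}$, every compact $K\subset V$ is contained in $U_m$ for all but finitely many $m$; (iii) every connected open set $N\ni v$ that is contained in $U_m$ for infinitely many $m$ is contained in $V$ (so if $V=\{v\}$, no connected open $N\ni v$ is contained in infinitely many $U_m$). **Proposition 4.1.** Let $\mathcal U=\{(U_\alpha,u_\alpha)\}_{\alpha\in A}$ be a family of pointed hyperbolic domains in $\mathbb C$ which is *non-degenerate*: whenever a sequence of members of $\mathcal U$ converges in the Carathéodory topology to some $(V,v)$, the limit $V$ is again a hyperbolic domain (in particular $V\ne\{v\}$). Let $\mathcal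 F=\{f_\alpha\}_{\alpha\in A}$ be a family of functions, each $f_\alpha:U_\alpha\to\overline{\mathbb C}$ being analytic as a map into the Riemann sphere (this includes ordinary analytic functions $U_\alpha\to\mathbb C$). Then the following are equivalent. 1. $\mathcal F$ is *normal* on $\mathcal U$: for every sequence $(U_{\alpha_m},u_{\alpha_m})$ in $\mathcal U$ which converges in the Carathéodory topology to some $(V,v)$ with $V\neq\{v\}$, there are a subsequence $(f_{\alpha_{m_k}})$ and an analytic $g:V\to\overline{\mathbb C}$ such that for every compact $K\subset V$ and every $\varepsilon>0$ one has $d^\#(f_{\alpha_{m_k}}(z),g(z))<\varepsilon$ for all $z\in K$ and all sufficiently large $k$. 2. $\mathcal F$ is *equicontinuous on compact subsets of* $\mathcal U$: for every $R>0$ there is $M\ge 0$ such that for every $\alpha\in A$ and all $z,w\in U_\alpha$ with $\rho_{U_\alpha}(u_\alpha,z)\le R$ and $\rho_{U_\alpha}(u_\alpha,w)\le R$, $$d^\#(f_\alpha(z),f_\alpha(w))\le M\,\rho_{U_\alpha}(z,w).$$ -/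

import Mathlib

open Set Filter Topology
open scoped ENNReal NNReal OnePoint ComplexConjugate

noncomputable section

/-! ### The Riemann sphere

The Riemann sphere is `OnePoint ℂ` with its one-point-compactification topology. -/

/-- The inversion `z ↦ 1 / z` of the Riemann sphere, exchanging `0` and `∞`. -/
def sphereInv : OnePoint ℂ → OnePoint ℂ
  | ∞ => ((0 : ℂ) : OnePoint ℂ)
  | (z : ℂ) => if z = 0 then ∞ else ((z⁻¹ : ℂ) : OnePoint ℂ)

/-- The spherical distance, i.e. the geodesic distance of the metric `|dz| / (1 + |z|^2)`
(total diameter `π / 2`). The sine of the distance of two finite points is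
`|z - w| / (√(1 + |z|^2) √(1 + |w|^2))`, and that of `z` and `∞` is `1 / √(1 + |z|^2)`. -/
def sphericalDist : OnePoint ℂ → OnePoint ℂ → ℝ
  | ∞, ∞ => 0
  | ∞, (w : ℂ) => Real.arcsin (1 / Real.sqrt (1 + ‖w‖ ^ 2))
  | (z : ℂ), ∞ => Real.arcsin (1 / Real.sqrt (1 + ‖z‖ ^ 2))
  | (z : ℂ), (w : ℂ) =>
      Real.arcsin (‖z - w‖ / (Real.sqrt (1 + ‖z‖ ^ 2) * Real.sqrt (1 + ‖w‖ ^ 2)))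

/-- `f` is analytic near `z` as a map into the Riemann sphere: near `z` either `f` or `1 / f`
is an ordinary analytic function. -/
def SphereAnalyticAt (f : ℂ → OnePoint ℂ) (z : ℂ) : Prop :=
  ∃ g : ℂ → ℂ, AnalyticAt ℂ g z ∧
    ((∀ᶠ w in 𝓝 z, f w = (g w : OnePoint ℂ)) ∨
      (∀ᶠ w in 𝓝 z, f w = sphereInv (g w : OnePoint ℂ)))

/-- `f` is analytic on `U` as a map into the Riemann sphere. Only the values on (a neighbourhood
of points of) the open set `U` matter. -/
def SphereAnalyticOn (f : ℂ → OnePoint ℂ) (U : Set ℂ) : Prop :=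
  ∀ z ∈ U, SphereAnalyticAt f z

/-! ### Hyperbolic domains and Carathéodory convergence -/

/-- A hyperbolic domain: an open connected subset of the Riemann sphere whose complement has at
least three points. -/
def IsHyperbolicDomain (V : Set (OnePoint ℂ)) : Prop :=
  IsOpen V ∧ IsConnected V ∧ 3 ≤ Vᶜ.encard

/-- A subset of the plane, regarded as a subset of the Riemann sphere. -/
def toSphere (U : Set ℂ) : Set (OnePoint ℂ) := (fun z : ℂ => (z : OnePoint ℂ)) '' U

/-- The pointed domains `(U m, u m)` converge to `(V, v)` in the Carathéodory topology. The limit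
is either a pointed domain of the sphere or the degenerate `({v}, v)`; in the degenerate case the
condition on compact subsets is void, and the last condition says that no connected open
neighbourhood of `v` lies in infinitely many `U m`. -/
structure CaratheodoryTendsto (U : ℕ → Set (OnePoint ℂ)) (u : ℕ → OnePoint ℂ)
    (V : Set (OnePoint ℂ)) (v : OnePoint ℂ) : Prop where
  mem : v ∈ V
  domain_or_degenerate : (IsOpen V ∧ IsConnected V) ∨ V = {v}
  base : Tendsto u atTop (𝓝 v)
  compact_subset : V ≠ {v} → ∀ K : Set (OnePoint ℂ), IsCompact K → K ⊆ V → ∀ᶠ m in atTop, K ⊆ U m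
  maximal : ∀ N : Set (OnePoint ℂ), IsOpen N → IsConnected N → v ∈ N →
    (∃ᶠ m in atTop, N ⊆ U m) → N ⊆ V

/-- A family of pointed hyperbolic domains in `ℂ` which is (hyperbolically) non-degenerate: the
limit of any Carathéodory convergent sequence of members is again a hyperbolic domain (in
particular it is not a single point). -/
structure IsNondegenerateFamily {A : Type*} (U : A → Set ℂ) (u : A → ℂ) : Prop where
  hyperbolic : ∀ a, IsHyperbolicDomain (toSphere (U a))
  base_mem : ∀ a, u a ∈ U a
  limit_hyperbolic : ∀ (s : ℕ → A) (V : Set (OnePoint ℂ)) (v : OnePoint ℂ),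
    CaratheodoryTendsto (fun m => toSphere (U (s m))) (fun m => (u (s m) : OnePoint ℂ)) V v →
      IsHyperbolicDomain V

/-! ### The hyperbolic metric -/

/-- The density `ρ_U` of the hyperbolic metric (curvature `-1`) of `U`, as the extremal metric for
holomorphic maps of the unit disc: the infimum of `2 / |f'(0)|` over all holomorphic `f` from the
unit disc to `U` with `f 0 = z` (where `2 / 0 = ∞`). For every holomorphic covering
`p` from the unit disc to `U` one has `ρ_U(p z) |p'(z)| = 2 / (1 - |z|^2)`, see
`hyperbolicDensity_covering`. -/
def hyperbolicDensity (U : Set ℂ) (z : ℂ) : ℝ≥0∞ :=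
  ⨅ (f : ℂ → ℂ) (_ : DifferentiableOn ℂ f (Metric.ball 0 1) ∧ MapsTo f (Metric.ball 0 1) U ∧
    f 0 = z), 2 / ‖deriv f 0‖ₑ

/-- The hyperbolic distance in `U`: the infimum of the hyperbolic lengths of the `C¹` paths in `U`
from `z` to `w` (the speed may vanish, so piecewise `C¹` curves are covered). -/
def hyperbolicDist (U : Set ℂ) (z w : ℂ) : ℝ≥0∞ :=
  ⨅ (γ : ℝ → ℂ) (_ : ContDiff ℝ 1 γ ∧ (∀ t ∈ Icc (0 : ℝ) 1, γ t ∈ U) ∧ γ 0 = z ∧ γ 1 = w),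
    ∫⁻ t in Icc (0 : ℝ) 1, hyperbolicDensity U (γ t) * ‖deriv γ t‖ₑ

/-! ### Normality and equicontinuity of families on varying domains -/

/-- `f m` converges to `g`, uniformly in the spherical distance on each compact subset of `V`. -/
def TendstoLocallyUnifSphere (f : ℕ → ℂ → OnePoint ℂ) (g : ℂ → OnePoint ℂ) (V : Set ℂ) : Prop :=
  ∀ K : Set ℂ, IsCompact K → K ⊆ V → ∀ ε : ℝ, 0 < ε → ∃ m₀ : ℕ, ∀ m, m₀ ≤ m →
    ∀ z ∈ K, sphericalDist (f m z) (g z) < ε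

/-- The family `f` is normal on the family of pointed domains `(U a, u a)`. Since the `U a` are
subsets of `ℂ`, a limit `V ≠ {v}` does not contain `∞`, so that it is the same as its part
in `ℂ`. -/
def IsNormalFamilyOn {A : Type*} (U : A → Set ℂ) (u : A → ℂ) (f : A → ℂ → OnePoint ℂ) : Prop :=
  ∀ (s : ℕ → A) (V : Set (OnePoint ℂ)) (v : OnePoint ℂ),
    CaratheodoryTendsto (fun m => toSphere (U (s m))) (fun m => (u (s m) : OnePoint ℂ)) V v →
    V ≠ {v} →
    ∃ φ : ℕ → ℕ, StrictMono φ ∧ ∃ g : ℂ → OnePoint ℂ,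
      SphereAnalyticOn g {z : ℂ | (z : OnePoint ℂ) ∈ V} ∧
      TendstoLocallyUnifSphere (fun m => f (s (φ m))) g {z : ℂ | (z : OnePoint ℂ) ∈ V}

/-- The family `f` is equicontinuous on compact subsets of the family of pointed domains: for each
hyperbolic radius `R` there is one constant `M` such that every `f a` is `M`-Lipschitz, from the
hyperbolic distance of `U a` to the spherical distance, within hyperbolic distance `R` of `u a`. -/
def IsEquicontinuousFamilyOn {A : Type*} (U : A → Set ℂ) (u : A → ℂ)
    (f : A → ℂ → OnePoint ℂ) : Prop :=
  ∀ R : ℝ≥0, 0 < R → ∃ M : ℝ≥0, ∀ a, ∀ z ∈ U a, ∀ w ∈ U a,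
    hyperbolicDist (U a) (u a) z ≤ R → hyperbolicDist (U a) (u a) w ≤ R →
      ENNReal.ofReal (sphericalDist (f a z) (f a w)) ≤ M * hyperbolicDist (U a) z w

/-! ### The hyperbolic density and coverings -/

/-- The disc automorphism `w ↦ (w - c) / (1 - conj c * w)`. -/
def discAut (c w : ℂ) : ℂ := (w - c) / (1 - conj c * w)

lemma discAut_den_ne {c w : ℂ} (hc : ‖c‖ < 1) (hw : ‖w‖ < 1) : 1 - conj c * w ≠ 0 := by
  intro h
  have h1 : ‖conj c * w‖ = 1 := by rw [← sub_eq_zero.mp h]; simp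
  rw [norm_mul, RCLike.norm_conj] at h1
  nlinarith [norm_nonneg c, norm_nonneg w]

lemma discAut_norm_lt {c w : ℂ} (hc : ‖c‖ < 1) (hw : ‖w‖ < 1) : ‖discAut c w‖ < 1 := by
  have hd := discAut_den_ne hc hw
  rw [discAut, norm_div, div_lt_one (norm_pos_iff.mpr hd)]
  refine lt_of_pow_lt_pow_left₀ 2 (norm_nonneg _) ?_
  rw [← Complex.normSq_eq_norm_sq, ← Complex.normSq_eq_norm_sq]
  have h1 : Complex.normSq c < 1 := by
    rw [Complex.normSq_eq_norm_sq]; nlinarith [norm_nonneg c]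
  have h2 : Complex.normSq w < 1 := by
    rw [Complex.normSq_eq_norm_sq]; nlinarith [norm_nonneg w]
  rw [Complex.normSq_apply] at h1 h2 ⊢
  rw [Complex.normSq_apply]
  simp
  nlinarith [mul_pos (sub_pos.mpr h1) (sub_pos.mpr h2)]

lemma discAut_hasDerivAt {c w : ℂ} (hc : ‖c‖ < 1) (hw : ‖w‖ < 1) :
    HasDerivAt (discAut c) ((1 - conj c * c) / (1 - conj c * w) ^ 2) w := by
  have hd := discAut_den_ne hc hw
  have h := ((hasDerivAt_id w).sub_const c).div
    (((hasDerivAt_id w).const_mul (conj c)).const_sub 1) hd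
  have he : (1 * (1 - conj c * id w) - (id w - c) * -(conj c * 1)) / (1 - conj c * id w) ^ 2 =
      (1 - conj c * c) / (1 - conj c * w) ^ 2 := by
    simp only [id]
    ring
  rw [← he]
  exact h

lemma norm_one_sub_conj_mul {c : ℂ} (hc : ‖c‖ < 1) : ‖1 - conj c * c‖ = 1 - ‖c‖ ^ 2 := by
  have : (1 - conj c * c : ℂ) = ((1 - ‖c‖ ^ 2 : ℝ) : ℂ) := by
    rw [Complex.conj_mul']; push_cast; ring
  rw [this, Complex.norm_real, Real.norm_eq_abs, abs_of_nonneg]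
  nlinarith [norm_nonneg c]

/-- The density is the push-forward of the Poincaré metric of the disc under any holomorphic
covering. -/
theorem hyperbolicDensity_covering {U : Set ℂ} (p : ℂ → ℂ)
    (hp : DifferentiableOn ℂ p (Metric.ball 0 1)) (hp' : ∀ z ∈ Metric.ball (0 : ℂ) 1, deriv p z ≠ 0)
    (hU : MapsTo p (Metric.ball 0 1) U) (hcov : IsCoveringMap hU.restrict)
    {a : ℂ} (ha : a ∈ Metric.ball (0 : ℂ) 1) :
    hyperbolicDensity U (p a) = 2 / ENNReal.ofReal (‖deriv p a‖ * (1 - ‖a‖ ^ 2)) := by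
  have ha1 : ‖a‖ < 1 := by simpa using ha
  have hna : ‖-a‖ < 1 := by simpa using ha1
  have hpos : 0 < 1 - ‖a‖ ^ 2 := by nlinarith [norm_nonneg a]
  have hpd : HasDerivAt p (deriv p a) a :=
    (hp.differentiableAt (Metric.isOpen_ball.mem_nhds ha)).hasDerivAt
  refine le_antisymm ?_ ?_
  · refine (iInf₂_le (p ∘ discAut (-a)) (And.intro ?_ (And.intro ?_ ?_))).trans (le_of_eq ?_)
    · refine DifferentiableOn.comp (t := Metric.ball 0 1) hp (fun w hw => ?_) (fun w hw => ?_)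
      · exact (discAut_hasDerivAt hna (by simpa using hw)).differentiableAt.differentiableWithinAt
      · simpa using discAut_norm_lt hna (by simpa using hw)
    · intro w hw
      exact hU (by simpa using discAut_norm_lt hna (by simpa using hw))
    · simp [discAut]
    · have h0 : discAut (-a) 0 = a := by simp [discAut]
      have h1 := discAut_hasDerivAt (w := 0) hna (by simp)
      have h2 : HasDerivAt (p ∘ discAut (-a)) _ 0 := HasDerivAt.comp 0 (by rw [h0]; exact hpd) h1
      rw [h2.deriv, ← ofReal_norm, norm_mul]
      have := norm_one_sub_conj_mul hna
      rw [norm_neg] at this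
      rw [← this]
      simp
  · refine le_iInf₂ fun f ⟨hf, hfU, hf0⟩ => ?_
    -- lift `f` through the covering
    have hcf : ContinuousOn f (Metric.ball 0 1) := hf.continuousOn
    let F : C(Metric.ball (0 : ℂ) 1, U) := ⟨hfU.restrict, hcf.mapsToRestrict hfU⟩
    have : ContractibleSpace (Metric.ball (0 : ℂ) 1) :=
      (convex_ball (0 : ℂ) 1).contractibleSpace ⟨0, by simp⟩
    have : LocallyPathConnectedSpace (Metric.ball (0 : ℂ) 1) :=
      Metric.isOpen_ball.locallyPathConnectedSpace
    have h00 : (0 : ℂ) ∈ Metric.ball (0 : ℂ) 1 := by simp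
    obtain ⟨G, ⟨hG0, hG⟩, -⟩ := hcov.existsUnique_continuousMap_lifts F (a₀ := ⟨0, h00⟩)
      (e₀ := ⟨a, ha⟩) (Subtype.ext (by simpa [F] using hf0.symm))
    classical
    let H : ℂ → ℂ := fun z => if hz : z ∈ Metric.ball (0 : ℂ) 1 then (G ⟨z, hz⟩ : ℂ) else 0
    have hHe : ∀ z (hz : z ∈ Metric.ball (0 : ℂ) 1), H z = G ⟨z, hz⟩ := fun z hz => dif_pos hz
    have hHm : MapsTo H (Metric.ball 0 1) (Metric.ball 0 1) := fun z hz => by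
      rw [hHe z hz]; exact (G ⟨z, hz⟩).2
    have hHp : ∀ z ∈ Metric.ball (0 : ℂ) 1, p (H z) = f z := fun z hz => by
      rw [hHe z hz]; exact congrArg Subtype.val (congrFun hG ⟨z, hz⟩)
    have hH0 : H 0 = a := by rw [hHe 0 h00, hG0]
    have hHc : ContinuousOn H (Metric.ball 0 1) := by
      rw [continuousOn_iff_continuous_domRestrict]
      have : (Metric.ball (0 : ℂ) 1).domRestrict H = fun z => (G z : ℂ) := by
        ext z; exact hHe z z.2
      rw [this]; exact continuous_subtype_val.comp G.continuous
    have hHd : DifferentiableOn ℂ H (Metric.ball 0 1) := by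
      intro z hz
      have hzn := Metric.isOpen_ball.mem_nhds hz
      have hs : HasStrictDerivAt p (deriv p (H z)) (H z) :=
        ((hp.analyticAt (Metric.isOpen_ball.mem_nhds (hHm hz))).hasStrictDerivAt)
      have hl := hs.to_localInverse (hp' _ (hHm hz))
      have hli := (hs.hasStrictFDerivAt_equiv (hp' _ (hHm hz))).eventually_left_inverse
      have hct := hHc.continuousAt hzn
      have hfd := hf.differentiableAt hzn
      refine DifferentiableAt.differentiableWithinAt ?_
      have hl' := hl.hasDerivAt.differentiableAt
      rw [hHp z hz] at hl'
      refine (hl'.comp z hfd).congr_of_eventuallyEq ?_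
      filter_upwards [hct.eventually hli, hzn] with w hw hwb
      rw [Function.comp_apply, ← hHp w hwb]
      exact hw.symm
    have hHa : HasDerivAt H (deriv H 0) 0 :=
      (hHd.differentiableAt (Metric.isOpen_ball.mem_nhds h00)).hasDerivAt
    have hfd : deriv f 0 = deriv p a * deriv H 0 := by
      have h : HasDerivAt (p ∘ H) (deriv p a * deriv H 0) 0 :=
        HasDerivAt.comp 0 (by rw [hH0]; exact hpd) hHa
      refine (h.congr_of_eventuallyEq ?_).deriv
      filter_upwards [Metric.isOpen_ball.mem_nhds h00] with w hw
      exact (hHp w hw).symm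
    have hS : ‖deriv H 0‖ ≤ 1 - ‖a‖ ^ 2 := by
      have hm : MapsTo (discAut a ∘ H) (Metric.ball 0 1) (Metric.ball ((discAut a ∘ H) 0) 1) := by
        intro w hw
        have : (discAut a ∘ H) 0 = 0 := by simp [hH0, discAut]
        rw [this]
        simpa using discAut_norm_lt ha1 (by simpa using hHm hw)
      have hd : DifferentiableOn ℂ (discAut a ∘ H) (Metric.ball 0 1) := by
        refine DifferentiableOn.comp (t := Metric.ball 0 1) (fun w hw => ?_) hHd hHm
        exact (discAut_hasDerivAt ha1 (by simpa using hw)).differentiableAt.differentiableWithinAt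
      have h1 := Complex.norm_deriv_le_one_of_mapsTo_ball hd (hm.mono_right Metric.ball_subset_closedBall) one_pos
      have h2 : HasDerivAt (discAut a ∘ H) _ 0 :=
        HasDerivAt.comp 0 (by rw [hH0]; exact discAut_hasDerivAt ha1 ha1) hHa
      rw [h2.deriv, norm_mul, norm_div, norm_pow, norm_one_sub_conj_mul ha1] at h1
      have h3 : (1 - ‖a‖ ^ 2) / (1 - ‖a‖ ^ 2) ^ 2 = (1 - ‖a‖ ^ 2)⁻¹ := by field_simp
      rw [h3, inv_mul_le_iff₀ hpos, mul_one] at h1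
      exact h1
    rw [hfd, ← ofReal_norm, norm_mul]
    exact ENNReal.div_le_div_left
      (ENNReal.ofReal_le_ofReal (mul_le_mul_of_nonneg_left hS (norm_nonneg _))) _

end

/-! Both conditions are local statements about the maps near a limit domain `V`, once the hyperbolic
geometry of the varying domains is compared with the euclidean geometry near `V`. Three facts about
domains `U m` converging to a hyperbolic `V` make this comparison. (a) Near a point of `V` the
hyperbolic distance to the base points is eventually bounded
(`PlanarTendsto.exists_hyperbolicDist_le`), and locally it is at most a constant times the euclidean
distance (`hyperbolicDist_le_of_ball`); both follow from the affine discs in the definition of the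
density. (b) Points at bounded hyperbolic distance from the base points accumulate in `V`, not on
its boundary or at infinity (`PlanarTendsto.exists_subseq_tendsto_mem`). (c) At such points the
hyperbolic distance is at least a constant times the euclidean one
(`PlanarTendsto.exists_mul_dist_le_hyperbolicDist`).

Facts (b) and (c) require a lower bound for the density of a domain omitting `a` and `b`, of order
`1 / (r (1 + |log (r / |b - a|)|))` with `r = |z - a|`. It is Landau's theorem, deduced here from
Bloch's theorem. The integral of this bound diverges both at `r = 0` and at `r = ∞`, so paths of
bounded length stay away from omitted points and from infinity. Hyperbolicity of `V` supplies pairs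
of omitted points of `U m` that are uniformly bounded and uniformly separated.

Equicontinuity implies normality: by (a) the maps are locally equi-Lipschitz into the compact
sphere, so Arzelà–Ascoli gives a convergent subsequence, whose limit is analytic by Weierstrass'
theorem. Conversely, if no constant `M` works, there are pairs of points violating the Lipschitz
bound with constants tending to infinity. Non-degeneracy gives a convergent subsequence of the
domains, normality one of the functions, and (b) one of the points. Cauchy's estimate bounds the
euclidean difference quotients, and (c) turns this into a contradiction. -/

noncomputable section

/-! ### The theorems of Bloch and Landau -/

/-- **Bloch's theorem** (with a crude constant). -/
theorem exists_ball_subset_image_of_differentiableOn_ball {F : ℂ → ℂ}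
    (hF : DifferentiableOn ℂ F (Metric.ball 0 1)) :
    ∃ c, Metric.ball c (‖deriv F 0‖ / 96) ⊆ F '' Metric.ball 0 1 := by
  rcases eq_or_ne (deriv F 0) 0 with h0 | h0
  · exact ⟨0, by simp [h0]⟩
  have hF' : DifferentiableOn ℂ (deriv F) (Metric.ball 0 1) := hF.deriv Metric.isOpen_ball
  have hsub : Metric.closedBall (0 : ℂ) (1 / 2) ⊆ Metric.ball 0 1 :=
    Metric.closedBall_subset_ball (by norm_num)
  -- Maximising the weighted derivative, and not `F` itself, gives a centre `p` around which `F'` is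
  -- at most `2 * A` on a disc of radius comparable to `d`, while `A * d` is at least half of
  -- `‖deriv F 0‖`.
  obtain ⟨p, hp, hmax⟩ := (isCompact_closedBall (0 : ℂ) (1 / 2)).exists_isMaxOn
    (f := fun z => ‖deriv F z‖ * (1 / 2 - ‖z‖)) ⟨0, by simp⟩
    ((hF'.continuousOn.mono hsub).norm.mul (continuousOn_const.sub continuous_norm.continuousOn))
  set A := ‖deriv F p‖ with hA
  set d := 1 / 2 - ‖p‖ with hd
  have hAd : ‖deriv F 0‖ / 2 ≤ A * d := by
    have : ‖deriv F 0‖ * (1 / 2 - ‖(0 : ℂ)‖) ≤ A * d :=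
      hmax (show (0 : ℂ) ∈ Metric.closedBall 0 (1 / 2) by simp)
    rw [norm_zero] at this
    linarith
  have hpn : ‖p‖ ≤ 1 / 2 := by simpa using hp
  have hAd0 : 0 < A * d := lt_of_lt_of_le (half_pos (norm_pos_iff.mpr h0)) hAd
  have hd0 : 0 < d := by
    by_contra h
    have : d = 0 := by linarith
    simp [this] at hAd0
  have hA0 : 0 < A := pos_of_mul_pos_left hAd0 hd0.le
  have hball : Metric.ball p (d / 2) ⊆ Metric.ball 0 1 := by
    apply Metric.ball_subset_ball'
    rw [dist_zero_right]
    linarith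
  have hbd : ∀ z ∈ Metric.ball p (d / 2), ‖deriv F z‖ ≤ 2 * A := by
    intro z hz
    have hz' : ‖z - p‖ < d / 2 := by simpa [dist_eq_norm] using hz
    have h1 : ‖z‖ ≤ ‖p‖ + ‖z - p‖ := by
      simpa using norm_add_le p (z - p)
    have h2 : ‖deriv F z‖ * (1 / 2 - ‖z‖) ≤ A * d := hmax (mem_closedBall_zero_iff.mpr (by linarith))
    have h3 : ‖deriv F z‖ * (d / 2) ≤ ‖deriv F z‖ * (1 / 2 - ‖z‖) :=
      mul_le_mul_of_nonneg_left (by linarith) (norm_nonneg _)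
    have h4 : ‖deriv F z‖ * (d / 2) ≤ A * d := h3.trans h2
    nlinarith
  -- Schwarz' lemma for `F'`, which maps the disc of radius `d / 2` into the disc of radius `3 * A`
  -- about `F' p`.
  have hlip : ∀ z ∈ Metric.ball p (d / 2), ‖deriv F z - deriv F p‖ ≤ 6 * A / d * ‖z - p‖ := by
    intro z hz
    have := Complex.dist_le_div_mul_dist_of_mapsTo_ball (R₂ := 3 * A) (hF'.mono hball)
      (fun w hw => by
        rw [Metric.mem_closedBall, dist_eq_norm]
        exact (norm_sub_le _ _).trans (by linarith [hbd w hw])) hz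
    rw [dist_eq_norm, dist_eq_norm] at this
    refine this.trans (le_of_eq ?_)
    field_simp
    ring
  have hsm : Metric.closedBall p (d / 12) ⊆ Metric.ball p (d / 2) :=
    Metric.closedBall_subset_ball (by linarith)
  have hdiff : ∀ z ∈ Metric.closedBall p (d / 12), DifferentiableAt ℂ F z := fun z hz =>
    hF.differentiableAt (Metric.isOpen_ball.mem_nhds (hball (hsm hz)))
  have hpd : HasDerivAt F (deriv F p) p :=
    (hdiff p (Metric.mem_closedBall_self (by linarith))).hasDerivAt
  -- On radius `d / 12` the derivative differs from `F' p` by at most `A / 2`, so `F` is close to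
  -- its linear part. On the circle this leaves `‖F z - F p‖ ≥ A * d / 12 - A * d / 24`. The open
  -- mapping estimate halves this to `A * d / 48`, which is at least `‖deriv F 0‖ / 96`.
  have happ : ∀ z ∈ Metric.closedBall p (d / 12),
      ‖(F z - deriv F p * z) - (F p - deriv F p * p)‖ ≤ A / 2 * ‖z - p‖ := by
    intro z hz
    refine (convex_closedBall p (d / 12)).norm_image_sub_le_of_norm_hasDerivWithin_le
      (f := fun z => F z - deriv F p * z) (f' := fun z => deriv F z - deriv F p)
      (fun w hw => ?_) (fun w hw => ?_) (Metric.mem_closedBall_self (by linarith)) hz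
    · have := (hdiff w hw).hasDerivAt.sub ((hasDerivAt_id w).const_mul (deriv F p))
      rw [mul_one] at this
      exact this.hasDerivWithinAt
    · have hw' : ‖w - p‖ ≤ d / 12 := by simpa [dist_eq_norm] using hw
      refine (hlip w (hsm hw)).trans ?_
      calc 6 * A / d * ‖w - p‖ ≤ 6 * A / d * (d / 12) := by gcongr
        _ = A / 2 := by field_simp; norm_num
  have himg := DiffContOnCl.ball_subset_image_closedBall (f := F) (z₀ := p) (r := d / 12)
    (ε := A * d / 24) ?_ (by linarith) ?_ ?_
  · refine ⟨F p, (Metric.ball_subset_ball ?_).trans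
      (himg.trans (image_mono (hsm.trans hball)))⟩
    linarith
  · refine DifferentiableOn.diffContOnCl fun z hz => ?_
    exact (hdiff z (Metric.closure_ball_subset_closedBall hz)).differentiableWithinAt
  · intro z hz
    have hzn : ‖z - p‖ = d / 12 := by simpa [dist_eq_norm] using hz
    have h1 := happ z (Metric.sphere_subset_closedBall hz)
    have h2 : ‖deriv F p * (z - p)‖ ≤ ‖F z - F p‖ +
        ‖(F z - deriv F p * z) - (F p - deriv F p * p)‖ := by
      refine (le_of_eq ?_).trans (norm_sub_le _ _)
      congr 1
      ring
    rw [norm_mul, hzn] at h2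
    rw [hzn] at h1
    have : A * (d / 12) = 2 * (A * d / 24) := by ring
    have : A / 2 * (d / 12) = A * d / 24 := by ring
    linarith
  · have : ∀ᶠ z in 𝓝[≠] p, F z ≠ F p := hpd.eventually_ne (norm_pos_iff.mp hA0)
    exact this.frequently.filter_mono nhdsWithin_le_nhds

/-- A holomorphic logarithm on the unit disc, with prescribed value at the centre. -/
theorem exists_log_on_ball {h : ℂ → ℂ} (hh : DifferentiableOn ℂ h (Metric.ball 0 1))
    (h0 : ∀ z ∈ Metric.ball (0 : ℂ) 1, h z ≠ 0) :
    ∃ g : ℂ → ℂ, DifferentiableOn ℂ g (Metric.ball 0 1) ∧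
      (∀ z ∈ Metric.ball (0 : ℂ) 1, Complex.exp (g z) = h z) ∧ g 0 = Complex.log (h 0) := by
  have hq : DifferentiableOn ℂ (fun z => deriv h z / h z) (Metric.ball 0 1) :=
    (hh.deriv Metric.isOpen_ball).div hh h0
  obtain ⟨g, hg0, hg⟩ := hq.isExactOn_ball.with_val_at 0 (Complex.log (h 0))
  have hz0 : (0 : ℂ) ∈ Metric.ball (0 : ℂ) 1 := by simp
  have hgd : DifferentiableOn ℂ g (Metric.ball 0 1) := fun z hz =>
    (hg z hz).differentiableAt.differentiableWithinAt
  refine ⟨g, hgd, fun z hz => ?_, hg0⟩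
  -- `h * exp (-g)` has derivative zero, hence is constant, and its value at `0` is `1`.
  have hder : ∀ w ∈ Metric.ball (0 : ℂ) 1,
      HasDerivAt (fun w => h w * Complex.exp (-g w)) 0 w := fun w hw => by
    have h1 := (hh.differentiableAt (Metric.isOpen_ball.mem_nhds hw)).hasDerivAt
    have h2 := h1.mul ((hg w hw).neg.cexp)
    have h3 : deriv h w * Complex.exp (-g w) +
        h w * (Complex.exp (-g w) * -(deriv h w / h w)) = 0 := by
      have := h0 w hw
      field_simp
      ring
    rw [← h3]
    exact h2
  have hc := (convex_ball (0 : ℂ) 1).is_const_of_fderivWithin_eq_zero (𝕜 := ℂ)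
    (f := fun w => h w * Complex.exp (-g w))
    (fun w hw => (hder w hw).differentiableAt.differentiableWithinAt)
    (fun w hw => by
      rw [fderivWithin_of_isOpen Metric.isOpen_ball hw]
      have := (hder w hw).hasFDerivAt.fderiv
      rw [this]; ext; simp) hz hz0
  simp only [hg0] at hc
  rw [Complex.exp_neg, Complex.exp_neg, Complex.exp_log (h0 0 hz0),
    mul_inv_cancel₀ (h0 0 hz0)] at hc
  have := Complex.exp_ne_zero (g z)
  field_simp at hc
  exact hc.symm

/-- Every point of the plane lies within distance `4` of a solution of `cosh z ∈ 2ℤ + 1`. -/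
theorem exists_cosh_eq_odd_near (c : ℂ) :
    ∃ z : ℂ, ‖z - c‖ < 4 ∧ ∃ k : ℤ, Complex.cosh z = 2 * k + 1 := by
  -- the real case, for a nonnegative point
  have key : ∀ x : ℝ, 0 ≤ x → ∃ y : ℝ, |y - x| < 2 ∧ ∃ k : ℤ, Real.cosh y = 2 * k + 1 := by
    -- `2 * k + 1` is the largest odd integer not exceeding `cosh x`. Hence `cosh x < cosh y + 2 ≤ 3
    -- * cosh y`, which gives `exp x < 6 * exp y < exp (2 + y)`.
    intro x hx
    set k : ℤ := ⌊(Real.cosh x - 1) / 2⌋ with hk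
    have hk0 : 0 ≤ k := Int.floor_nonneg.mpr (by linarith [Real.one_le_cosh x])
    have hk0' : (0 : ℝ) ≤ k := by exact_mod_cast hk0
    have hk1 : (k : ℝ) ≤ (Real.cosh x - 1) / 2 := Int.floor_le _
    have hk2 : (Real.cosh x - 1) / 2 < k + 1 := Int.lt_floor_add_one _
    have h1 : (1 : ℝ) ≤ 2 * k + 1 := by linarith
    refine ⟨Real.arcosh (2 * k + 1), ?_, k, Real.cosh_arcosh h1⟩
    have hy0 := Real.arcosh_nonneg h1
    set y := Real.arcosh (2 * k + 1)
    have hcy : Real.cosh y = 2 * k + 1 := Real.cosh_arcosh h1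
    have hyx : y ≤ x := by
      rw [← Real.arcosh_cosh hx]
      exact (Real.arcosh_le_arcosh (by linarith) (by linarith [Real.one_le_cosh x])).mpr
        (by linarith)
    have h2 : Real.exp x < 6 * Real.exp y := by
      have e1 := Real.cosh_eq x
      have e2 := Real.cosh_eq y
      have e3 : Real.exp (-y) ≤ Real.exp y := Real.exp_le_exp.mpr (by linarith)
      have e4 := Real.exp_pos (-x)
      linarith
    have h3 : (6 : ℝ) < Real.exp 2 := by
      have := Real.exp_one_gt_d9
      have h : Real.exp 2 = Real.exp 1 * Real.exp 1 := by rw [← Real.exp_add]; norm_num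
      rw [h]; nlinarith
    have h4 : Real.exp x < Real.exp (2 + y) := by
      rw [Real.exp_add]
      have := Real.exp_pos y
      nlinarith
    have h5 := Real.exp_lt_exp.mp h4
    rw [abs_lt]; constructor <;> linarith
  have key' : ∀ x : ℝ, ∃ y : ℝ, |y - x| < 2 ∧ ∃ k : ℤ, Real.cosh y = 2 * k + 1 := by
    intro x
    rcases le_total 0 x with hx | hx
    · exact key x hx
    · obtain ⟨y, hy, k, hk⟩ := key (-x) (by linarith)
      refine ⟨-y, ?_, k, by rw [Real.cosh_neg, hk]⟩
      rw [abs_lt] at hy ⊢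
      constructor <;> linarith [hy.1, hy.2]
  obtain ⟨y, hy, k, hk⟩ := key' c.re
  -- Adding `m * π * I` multiplies `cosh` by `(-1) ^ m`, and odd integers are stable under sign
  -- change. The multiple of `π` nearest to `c.im` is at distance at most `π / 2 < 2`.
  set m : ℤ := round (c.im / Real.pi) with hm
  have hmr : |c.im / Real.pi - m| ≤ 1 / 2 := abs_sub_round _
  have him : |m * Real.pi - c.im| < 2 := by
    have h1 : (m * Real.pi - c.im) = -((c.im / Real.pi - m) * Real.pi) := by
      field_simp; ring
    rw [h1, abs_neg, abs_mul, abs_of_pos Real.pi_pos]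
    nlinarith [Real.pi_lt_d2, Real.pi_pos]
  refine ⟨⟨y, m * Real.pi⟩, ?_, ?_⟩
  · refine (Complex.norm_le_abs_re_add_abs_im _).trans_lt ?_
    simp only [Complex.sub_re, Complex.sub_im]
    linarith
  · have hz : (⟨y, m * Real.pi⟩ : ℂ) = (y : ℂ) + (m : ℂ) * (Real.pi * Complex.I) := by
      apply Complex.ext <;> simp
    have hc : Complex.cosh y = 2 * k + 1 := by
      rw [← Complex.ofReal_cosh, hk]; push_cast; rfl
    have hs : Complex.sinh ((m : ℂ) * (Real.pi * Complex.I)) = 0 := by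
      rw [← mul_assoc, Complex.sinh_mul_I, Complex.sin_int_mul_pi, zero_mul]
    have hcm : Complex.cosh ((m : ℂ) * (Real.pi * Complex.I)) = (-1) ^ m := by
      rw [← mul_assoc, Complex.cosh_mul_I]
      have := congrArg (fun x : ℝ => (x : ℂ)) (Real.cos_int_mul_pi m)
      push_cast at this
      exact this
    rw [hz, Complex.cosh_add, hs, mul_zero, add_zero, hc, hcm]
    rcases Int.even_or_odd m with h | h
    · exact ⟨k, by rw [h.neg_one_zpow]; ring⟩
    · exact ⟨-k - 1, by rw [h.neg_one_zpow]; push_cast; ring⟩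

/-- **Landau's theorem**: a bound for the derivative at the centre of a holomorphic function on the
unit disc which omits `0` and `1`. -/
theorem norm_deriv_le_of_omits_zero_one : ∃ C : ℝ, 1 ≤ C ∧ ∀ h : ℂ → ℂ,
    DifferentiableOn ℂ h (Metric.ball 0 1) → (∀ z ∈ Metric.ball (0 : ℂ) 1, h z ≠ 0) →
    (∀ z ∈ Metric.ball (0 : ℂ) 1, h z ≠ 1) →
    ‖deriv h 0‖ ≤ C * (‖h 0‖ * (1 + |Real.log ‖h 0‖|)) := by
  refine ⟨384 * (3 * Real.pi), by nlinarith [Real.pi_gt_three], fun h hh h0 h1 => ?_⟩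
  have hz0 : (0 : ℂ) ∈ Metric.ball (0 : ℂ) 1 := by simp
  have hpi : (Real.pi : ℂ) * Complex.I ≠ 0 := by
    simp [Real.pi_ne_zero]
  obtain ⟨g, hgd, hg, hg0⟩ := exists_log_on_ball hh h0
  -- As `h = exp g` omits `1`, the function `g / (π * I)` omits the even integers and `K` the odd
  -- ones. In particular `K` omits `1` and `-1`, so `K = cosh F` can be solved for a holomorphic
  -- `F`, through a square root of `K ^ 2 - 1` and a logarithm.
  set K : ℂ → ℂ := fun z => g z / (Real.pi * Complex.I) - 1 with hK
  have hKd : DifferentiableOn ℂ K (Metric.ball 0 1) := (hgd.div_const _).sub_const 1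
  have hKomit : ∀ z ∈ Metric.ball (0 : ℂ) 1, ∀ k : ℤ, K z ≠ 2 * k + 1 := by
    intro z hz k hk
    apply h1 z hz
    rw [← hg z hz, Complex.exp_eq_one_iff]
    refine ⟨k + 1, ?_⟩
    have : g z / (Real.pi * Complex.I) = 2 * k + 2 := by
      have : g z / (Real.pi * Complex.I) = K z + 1 := by simp [hK]
      rw [this, hk]; ring
    rw [div_eq_iff hpi] at this
    rw [this]; push_cast; ring
  -- a square root of `K ^ 2 - 1`
  obtain ⟨q, hqd, hq, -⟩ := exists_log_on_ball (h := fun z => K z ^ 2 - 1)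
    ((hKd.pow 2).sub_const 1) (fun z hz h => by
      have : (K z - 1) * (K z + 1) = 0 := by rw [← h]; ring
      rcases mul_eq_zero.mp this with h | h
      · exact hKomit z hz 0 (by rw [sub_eq_zero.mp h]; simp)
      · exact hKomit z hz (-1) (by rw [eq_neg_of_add_eq_zero_left h]; norm_num))
  set S : ℂ → ℂ := fun z => Complex.exp (q z / 2) with hS
  have hS2 : ∀ z ∈ Metric.ball (0 : ℂ) 1, S z ^ 2 = K z ^ 2 - 1 := fun z hz => by
    rw [← hq z hz, hS, ← Complex.exp_nat_mul]
    congr 1; push_cast; ring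
  have hprod : ∀ z ∈ Metric.ball (0 : ℂ) 1, (K z + S z) * (K z - S z) = 1 := fun z hz => by
    have := hS2 z hz
    linear_combination -this
  obtain ⟨F, hFd, hF, -⟩ := exists_log_on_ball (h := fun z => K z + S z)
    (hKd.add (hqd.div_const 2).cexp) (fun z hz h => by
      have := hprod z hz
      rw [h, zero_mul] at this
      exact zero_ne_one this)
  have hF' : ∀ z ∈ Metric.ball (0 : ℂ) 1, Complex.exp (-F z) = K z - S z := fun z hz => by
    rw [Complex.exp_neg, hF z hz]
    exact inv_eq_of_mul_eq_one_right (hprod z hz)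
  have hcosh : ∀ z ∈ Metric.ball (0 : ℂ) 1, Complex.cosh (F z) = K z := fun z hz => by
    rw [Complex.cosh, hF z hz, hF' z hz]; ring
  have hsinh : Complex.sinh (F 0) = S 0 := by
    rw [Complex.sinh, hF 0 hz0, hF' 0 hz0]; ring
  -- The image of `F` misses the solutions of `cosh w ∈ 2ℤ + 1`, which meet every disc of radius
  -- `4`. Bloch's theorem then gives the bound `4 * 96 = 384`.
  have hFb : ‖deriv F 0‖ ≤ 384 := by
    by_contra! hlt
    obtain ⟨c, hc⟩ := exists_ball_subset_image_of_differentiableOn_ball hFd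
    obtain ⟨w, hw, k, hk⟩ := exists_cosh_eq_odd_near c
    obtain ⟨z, hz, hzw⟩ := hc (show w ∈ Metric.ball c (‖deriv F 0‖ / 96) by
      rw [Metric.mem_ball, dist_eq_norm]; linarith)
    exact hKomit z hz k (by rw [← hcosh z hz, hzw, hk])
  have hnh := Metric.isOpen_ball.mem_nhds hz0
  have hKder : deriv K 0 = S 0 * deriv F 0 := by
    have h2 := ((hFd.differentiableAt hnh).hasDerivAt).ccosh
    rw [hsinh] at h2
    refine (h2.congr_of_eventuallyEq ?_).deriv
    filter_upwards [hnh] with z hz using (hcosh z hz).symm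
  have hhder : deriv h 0 = h 0 * (Real.pi * Complex.I * (S 0 * deriv F 0)) := by
    have h2 : HasDerivAt g (Real.pi * Complex.I * deriv K 0) 0 := by
      have h3 := (((hKd.differentiableAt hnh).hasDerivAt.add_const 1).const_mul
        (Real.pi * Complex.I))
      refine h3.congr_of_eventuallyEq (Eventually.of_forall fun z => ?_)
      simp only [hK]
      field_simp
      ring
    rw [hKder] at h2
    have h4 := h2.cexp
    rw [hg 0 hz0] at h4
    refine (h4.congr_of_eventuallyEq ?_).deriv
    filter_upwards [hnh] with z hz using (hg z hz).symm
  have hK0 : ‖K 0‖ ≤ 2 + |Real.log ‖h 0‖| := by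
    have e1 : ‖Complex.log (h 0)‖ ≤ |Real.log ‖h 0‖| + Real.pi := by
      refine (Complex.norm_le_abs_re_add_abs_im _).trans ?_
      rw [Complex.log_re, Complex.log_im]
      gcongr
      exact Complex.abs_arg_le_pi _
    have e2 : ‖K 0‖ ≤ ‖Complex.log (h 0)‖ / Real.pi + 1 := by
      refine (norm_sub_le _ _).trans ?_
      simp [hg0, abs_of_pos Real.pi_pos]
    have e3 : ‖Complex.log (h 0)‖ / Real.pi ≤ |Real.log ‖h 0‖| + 1 := by
      rw [div_le_iff₀ Real.pi_pos]
      nlinarith [Real.pi_gt_three, abs_nonneg (Real.log ‖h 0‖)]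
    linarith
  have hSn : ‖S 0‖ ≤ 3 + |Real.log ‖h 0‖| := by
    have e1 : ‖S 0‖ ^ 2 ≤ ‖K 0‖ ^ 2 + 1 := by
      rw [← norm_pow, hS2 0 hz0]
      exact (norm_sub_le _ _).trans (by simp)
    nlinarith [norm_nonneg (K 0), norm_nonneg (S 0), abs_nonneg (Real.log ‖h 0‖)]
  rw [hhder]
  simp only [norm_mul, Complex.norm_real, Complex.norm_I, mul_one, Real.norm_eq_abs,
    abs_of_pos Real.pi_pos]
  calc ‖h 0‖ * (Real.pi * (‖S 0‖ * ‖deriv F 0‖))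
      ≤ ‖h 0‖ * (Real.pi * ((3 * (1 + |Real.log ‖h 0‖|)) * 384)) := by
        gcongr
        linarith [abs_nonneg (Real.log ‖h 0‖)]
    _ = _ := by ring

/-! ### Estimates for the hyperbolic density, length and distance -/

/-- The hyperbolic length of the path `γ` on `[0, 1]`. -/
def hyperbolicLength (U : Set ℂ) (γ : ℝ → ℂ) : ℝ≥0∞ :=
  ∫⁻ t in Icc (0 : ℝ) 1, hyperbolicDensity U (γ t) * ‖deriv γ t‖ₑ

/-- Landau's theorem applied to `(f - a) / (b - a)`, for each competitor `f` in the definition of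
the density. -/
lemma hyperbolicDensity_lower_bound : ∃ C : ℝ, 1 ≤ C ∧ ∀ (U : Set ℂ) (a b : ℂ), a ∉ U → b ∉ U →
    a ≠ b → ∀ z ∈ U, ENNReal.ofReal (1 / (C * (‖z - a‖ *
      (1 + |Real.log (‖z - a‖ / ‖b - a‖)|)))) ≤ hyperbolicDensity U z := by
  obtain ⟨C, hC1, hC⟩ := norm_deriv_le_of_omits_zero_one
  refine ⟨C, hC1, fun U a b ha hb hab z hz => le_iInf₂ fun f ⟨hf, hfU, hf0⟩ => ?_⟩
  have hba : b - a ≠ 0 := sub_ne_zero.mpr hab.symm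
  have hza : 0 < ‖z - a‖ := norm_pos_iff.mpr (sub_ne_zero.mpr fun h => ha (h ▸ hz))
  have hz0 : (0 : ℂ) ∈ Metric.ball (0 : ℂ) 1 := by simp
  have h := hC (fun w => (f w - a) / (b - a)) ((hf.sub_const a).div_const _)
    (fun w hw h => by
      rw [div_eq_zero_iff, or_iff_left hba, sub_eq_zero] at h
      exact ha (h ▸ hfU hw))
    (fun w hw h => by
      rw [div_eq_one_iff_eq hba, sub_left_inj] at h
      exact hb (h ▸ hfU hw))
  have hd : HasDerivAt (fun w => (f w - a) / (b - a)) (deriv f 0 / (b - a)) 0 :=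
    ((hf.differentiableAt (Metric.isOpen_ball.mem_nhds hz0)).hasDerivAt.sub_const a).div_const _
  rw [hd.deriv, hf0, norm_div, norm_div] at h
  have hbn : 0 < ‖b - a‖ := norm_pos_iff.mpr hba
  have h2 : ‖deriv f 0‖ ≤ C * (‖z - a‖ * (1 + |Real.log (‖z - a‖ / ‖b - a‖)|)) := by
    have e : C * (‖z - a‖ / ‖b - a‖ * (1 + |Real.log (‖z - a‖ / ‖b - a‖)|)) =
      C * (‖z - a‖ * (1 + |Real.log (‖z - a‖ / ‖b - a‖)|)) / ‖b - a‖ := by ring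
    rw [e] at h
    exact (div_le_div_iff_of_pos_right hbn).mp h
  have hX : 0 < C * (‖z - a‖ * (1 + |Real.log (‖z - a‖ / ‖b - a‖)|)) := by positivity
  rw [ENNReal.ofReal_div_of_pos hX, ENNReal.ofReal_one, ← ofReal_norm]
  exact ENNReal.div_le_div (by norm_num) (ENNReal.ofReal_le_ofReal h2)

/-- A function of `z`, adapted to a domain omitting `a` and `b`, which is Lipschitz for the
hyperbolic metric of that domain. -/
def omitHeight (a b z : ℂ) : ℝ := Real.arsinh (Real.log (‖z - a‖ / ‖b - a‖))

lemma hasDerivAt_omitHeight_comp {a b : ℂ} (hab : a ≠ b) {γ : ℝ → ℂ} {γ' : ℂ} {t : ℝ}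
    (hγ : HasDerivAt γ γ' t) (ht : γ t ≠ a) :
    HasDerivAt (fun t => omitHeight a b (γ t))
      ((√(1 + Real.log (‖γ t - a‖ / ‖b - a‖) ^ 2))⁻¹ * (inner ℝ (γ t - a) γ' / ‖γ t - a‖ ^ 2)) t := by
  have hta : ‖γ t - a‖ ^ 2 ≠ 0 := pow_ne_zero 2 (norm_ne_zero_iff.mpr (sub_ne_zero.mpr ht))
  have h1 := ((hγ.sub_const a).norm_sq.log hta).const_mul (1 / 2 : ℝ)
  have h2 := h1.sub_const (Real.log ‖b - a‖)
  have hev : (fun t => 1 / 2 * Real.log (‖γ t - a‖ ^ 2) - Real.log ‖b - a‖) =ᶠ[𝓝 t]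
      fun t => Real.log (‖γ t - a‖ / ‖b - a‖) := by
    filter_upwards [hγ.continuousAt.eventually_ne ht] with s hs
    rw [Real.log_div (norm_ne_zero_iff.mpr (sub_ne_zero.mpr hs))
      (norm_ne_zero_iff.mpr (sub_ne_zero.mpr hab.symm)), Real.log_pow]
    push_cast; ring
  have h3 := (h2.congr_of_eventuallyEq hev.symm).arsinh
  simp only [smul_eq_mul] at h3
  have e : inner ℝ (γ t - a) γ' / ‖γ t - a‖ ^ 2 =
      1 / 2 * (2 * inner ℝ (γ t - a) γ' / ‖γ t - a‖ ^ 2) := by ring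
  rw [e]
  exact h3

/-- In the variable `x = log (r / ‖b - a‖)` with `r = ‖z - a‖`, the lower bound of the density is a
multiple of `|dx| / (1 + |x|)`. The derivative of `arsinh` is at most `2 / (1 + |x|)`, whence the
factor `2`. Since `arsinh` is unbounded in both directions, the lemma keeps short paths away from
`a` and from infinity. -/
lemma omitHeight_lipschitz : ∃ C : ℝ, 1 ≤ C ∧ ∀ (U : Set ℂ) (a b : ℂ), a ∉ U → b ∉ U →
    a ≠ b → ∀ γ : ℝ → ℂ, ContDiff ℝ 1 γ → (∀ t ∈ Icc (0 : ℝ) 1, γ t ∈ U) → ∀ s ∈ Icc (0 : ℝ) 1,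
      ENNReal.ofReal |omitHeight a b (γ s) - omitHeight a b (γ 0)| ≤
        ENNReal.ofReal C * hyperbolicLength U γ := by
  obtain ⟨C, hC1, hC⟩ := hyperbolicDensity_lower_bound
  refine ⟨2 * C, by linarith, fun U a b ha hb hab γ hγ hγU s hs => ?_⟩
  have hne : ∀ t ∈ Icc (0 : ℝ) 1, γ t ≠ a := fun t ht h => ha (h ▸ hγU t ht)
  have hsub : Icc 0 s ⊆ Icc (0 : ℝ) 1 := Icc_subset_Icc_right hs.2
  have hγd : ∀ t, HasDerivAt γ (deriv γ t) t := fun t =>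
    (hγ.differentiable one_ne_zero t).hasDerivAt
  set D : ℝ → ℝ := fun t => (√(1 + Real.log (‖γ t - a‖ / ‖b - a‖) ^ 2))⁻¹ *
    (inner ℝ (γ t - a) (deriv γ t) / ‖γ t - a‖ ^ 2) with hD
  have hn : ∀ t ∈ Icc (0 : ℝ) 1, ‖γ t - a‖ ≠ 0 := fun t ht =>
    norm_ne_zero_iff.mpr (sub_ne_zero.mpr (hne t ht))
  have hbn : ‖b - a‖ ≠ 0 := norm_ne_zero_iff.mpr (sub_ne_zero.mpr hab.symm)
  have hDc : ContinuousOn D (Icc 0 1) := by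
    have h1 : Continuous (fun t => ‖γ t - a‖) := (hγ.continuous.sub continuous_const).norm
    have h2 : Continuous (fun t => inner ℝ (γ t - a) (deriv γ t)) :=
      (hγ.continuous.sub continuous_const).inner (hγ.continuous_deriv le_rfl)
    refine ContinuousOn.mul (ContinuousOn.inv₀ ?_ fun t _ => by positivity)
      (h2.continuousOn.div (h1.pow 2).continuousOn fun t ht => pow_ne_zero 2 (hn t ht))
    refine (continuousOn_const.add (ContinuousOn.pow ?_ 2)).sqrt
    exact (h1.div_const _).continuousOn.log fun t ht => div_ne_zero (hn t ht) hbn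
  have hint := intervalIntegral.integral_eq_sub_of_hasDerivAt (a := 0) (b := s)
    (f := fun t => omitHeight a b (γ t)) (f' := D)
    (fun t ht => hasDerivAt_omitHeight_comp hab (hγd t)
      (hne t (hsub (by rwa [uIcc_of_le hs.1] at ht))))
    ((hDc.mono (by rw [uIcc_of_le hs.1]; exact hsub)).intervalIntegrable)
  have hbd : ∀ t ∈ Icc (0 : ℝ) 1,
      ‖D t‖ₑ ≤ ENNReal.ofReal (2 * C) * (hyperbolicDensity U (γ t) * ‖deriv γ t‖ₑ) := by
    intro t ht
    have hp : 0 < ‖γ t - a‖ := (norm_nonneg _).lt_of_ne (hn t ht).symm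
    set ℓ := Real.log (‖γ t - a‖ / ‖b - a‖) with hℓ
    have hs1 : (√(1 + ℓ ^ 2))⁻¹ ≤ 2 / (1 + |ℓ|) := by
      rw [inv_le_comm₀ (by positivity) (by positivity), inv_div]
      apply Real.le_sqrt_of_sq_le
      nlinarith [sq_nonneg (1 - |ℓ|), sq_abs ℓ]
    have hDr : |D t| ≤ 2 * C * (1 / (C * (‖γ t - a‖ * (1 + |ℓ|))) * ‖deriv γ t‖) := by
      have h1 : |inner ℝ (γ t - a) (deriv γ t)| ≤ ‖γ t - a‖ * ‖deriv γ t‖ :=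
        abs_real_inner_le_norm _ _
      rw [hD]
      simp only
      rw [abs_mul, abs_div, abs_inv, abs_of_nonneg (Real.sqrt_nonneg _),
        abs_of_pos (pow_pos hp 2)]
      calc (√(1 + ℓ ^ 2))⁻¹ * (|inner ℝ (γ t - a) (deriv γ t)| / ‖γ t - a‖ ^ 2)
          ≤ 2 / (1 + |ℓ|) * (‖γ t - a‖ * ‖deriv γ t‖ / ‖γ t - a‖ ^ 2) := by gcongr
        _ = _ := by field_simp
    rw [Real.enorm_eq_ofReal_abs]
    refine (ENNReal.ofReal_le_ofReal hDr).trans ?_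
    rw [ENNReal.ofReal_mul (by positivity), ENNReal.ofReal_mul (p := 1 / _) (by positivity),
      ofReal_norm]
    gcongr
    exact hC U a b ha hb hab _ (hγU t ht)
  rw [← hint, ← Real.enorm_eq_ofReal_abs, intervalIntegral.integral_of_le hs.1]
  calc ‖∫ t in Ioc 0 s, D t‖ₑ ≤ ∫⁻ t in Ioc 0 s, ‖D t‖ₑ :=
        MeasureTheory.enorm_integral_le_lintegral_enorm _
    _ ≤ ∫⁻ t in Icc (0 : ℝ) 1, ‖D t‖ₑ :=
        MeasureTheory.lintegral_mono_set (Ioc_subset_Icc_self.trans hsub)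
    _ ≤ ∫⁻ t in Icc (0 : ℝ) 1, ENNReal.ofReal (2 * C) *
          (hyperbolicDensity U (γ t) * ‖deriv γ t‖ₑ) :=
        MeasureTheory.setLIntegral_mono' measurableSet_Icc hbd
    _ = _ := MeasureTheory.lintegral_const_mul' _ _ ENNReal.ofReal_ne_top

lemma mul_dist_le_hyperbolicLength {U : Set ℂ} {γ : ℝ → ℂ} (hγ : ContDiff ℝ 1 γ) {c : ℝ≥0∞}
    (hctop : c ≠ ⊤) (hc : ∀ t ∈ Icc (0 : ℝ) 1, c ≤ hyperbolicDensity U (γ t)) :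
    c * ‖γ 1 - γ 0‖ₑ ≤ hyperbolicLength U γ := by
  have hint := intervalIntegral.integral_eq_sub_of_hasDerivAt (a := 0) (b := 1)
    (f := γ) (f' := deriv γ) (fun t _ => (hγ.differentiable one_ne_zero t).hasDerivAt)
    ((hγ.continuous_deriv le_rfl).intervalIntegrable _ _)
  rw [← hint, intervalIntegral.integral_of_le zero_le_one]
  calc c * ‖∫ t in Ioc 0 1, deriv γ t‖ₑ ≤ c * ∫⁻ t in Icc (0 : ℝ) 1, ‖deriv γ t‖ₑ := by
        gcongr
        exact (MeasureTheory.enorm_integral_le_lintegral_enorm _).trans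
          (MeasureTheory.lintegral_mono_set Ioc_subset_Icc_self)
    _ = ∫⁻ t in Icc (0 : ℝ) 1, c * ‖deriv γ t‖ₑ :=
        (MeasureTheory.lintegral_const_mul' _ _ hctop).symm
    _ ≤ _ := MeasureTheory.setLIntegral_mono' measurableSet_Icc fun t ht => by
        gcongr; exact hc t ht

lemma exists_path_of_hyperbolicDist_lt {U : Set ℂ} {z w : ℂ} {r : ℝ≥0∞}
    (h : hyperbolicDist U z w < r) : ∃ γ : ℝ → ℂ, ContDiff ℝ 1 γ ∧
      (∀ t ∈ Icc (0 : ℝ) 1, γ t ∈ U) ∧ γ 0 = z ∧ γ 1 = w ∧ hyperbolicLength U γ < r := by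
  rw [hyperbolicDist] at h
  simp only [iInf_lt_iff] at h
  obtain ⟨γ, ⟨h1, h2, h3, h4⟩, h5⟩ := h
  exact ⟨γ, h1, h2, h3, h4, h5⟩

/-- The competitor is the affine disc `w ↦ z + r * w`. -/
lemma hyperbolicDensity_le_of_ball {U : Set ℂ} {z : ℂ} {r : ℝ} (hr : 0 < r)
    (h : Metric.ball z r ⊆ U) : hyperbolicDensity U z ≤ ENNReal.ofReal (2 / r) := by
  have hd : ∀ w : ℂ, HasDerivAt (fun w : ℂ => z + r * w) r w := fun w => by
    simpa using ((hasDerivAt_id w).const_mul (r : ℂ)).const_add z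
  have hm : DifferentiableOn ℂ (fun w : ℂ => z + r * w) (Metric.ball 0 1) ∧
      MapsTo (fun w : ℂ => z + r * w) (Metric.ball 0 1) U ∧ z + r * (0 : ℂ) = z := by
    refine ⟨fun w _ => (hd w).differentiableAt.differentiableWithinAt, fun w hw => ?_,
      by simp⟩
    apply h
    have hw' : ‖w‖ < 1 := by simpa using hw
    rw [Metric.mem_ball, dist_eq_norm, add_sub_cancel_left, norm_mul, Complex.norm_real,
      Real.norm_eq_abs, abs_of_pos hr]
    nlinarith
  refine (iInf₂_le (fun w : ℂ => z + r * w) hm).trans (le_of_eq ?_)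
  rw [(hd 0).deriv, ← ofReal_norm, Complex.norm_real, Real.norm_eq_abs, abs_of_pos hr,
    ENNReal.ofReal_div_of_pos hr]
  simp

lemma hyperbolicDist_le_of_path {U : Set ℂ} {γ : ℝ → ℂ} (hγ : ContDiff ℝ 1 γ) {r B : ℝ}
    (hr : 0 < r) (hU : ∀ t ∈ Icc (0 : ℝ) 1, Metric.ball (γ t) r ⊆ U)
    (hB : ∀ t ∈ Icc (0 : ℝ) 1, ‖deriv γ t‖ ≤ B) :
    hyperbolicDist U (γ 0) (γ 1) ≤ ENNReal.ofReal (2 / r * B) := by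
  refine (iInf₂_le γ ⟨hγ, fun t ht => hU t ht (Metric.mem_ball_self hr), rfl, rfl⟩).trans ?_
  calc ∫⁻ t in Icc (0 : ℝ) 1, hyperbolicDensity U (γ t) * ‖deriv γ t‖ₑ
      ≤ ∫⁻ _ in Icc (0 : ℝ) 1, ENNReal.ofReal (2 / r * B) := by
        refine MeasureTheory.setLIntegral_mono' measurableSet_Icc fun t ht => ?_
        rw [ENNReal.ofReal_mul (by positivity), ← ofReal_norm]
        gcongr
        · exact hyperbolicDensity_le_of_ball hr (hU t ht)
        · exact hB t ht
    _ = _ := by simp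

lemma hyperbolicDist_le_of_ball {U : Set ℂ} {z w : ℂ} {r : ℝ} (hr : 0 < r)
    (h : Metric.ball z (2 * r) ⊆ U) (hw : ‖w - z‖ ≤ r) :
    hyperbolicDist U z w ≤ ENNReal.ofReal (2 / r * ‖w - z‖) := by
  have hd : ∀ t : ℝ, HasDerivAt (fun t : ℝ => z + (t : ℂ) * (w - z)) (w - z) t := fun t => by
    simpa using ((Complex.ofRealCLM.hasDerivAt (x := t)).mul_const (w - z)).const_add z
  have := hyperbolicDist_le_of_path (U := U) (γ := fun t : ℝ => z + (t : ℂ) * (w - z)) (r := r)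
    (B := ‖w - z‖) ?_ hr (fun t ht => ?_) (fun t _ => by rw [(hd t).deriv])
  · simpa using this
  · exact contDiff_const.add (Complex.ofRealCLM.contDiff.mul contDiff_const)
  · refine (Metric.ball_subset_ball' ?_).trans h
    rw [dist_eq_norm, add_sub_cancel_left, norm_mul, Complex.norm_real, Real.norm_eq_abs,
      abs_of_nonneg ht.1]
    nlinarith [ht.2, norm_nonneg (w - z)]

/-! ### The Riemann sphere as a round sphere in `ℂ × ℝ` -/

/-- The embedding of the Riemann sphere as the sphere of radius `1 / 2` in `ℂ × ℝ` with
south pole at the origin. -/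
def sphereEmb : OnePoint ℂ → ℂ × ℝ
  | ∞ => (0, 1)
  | (z : ℂ) => (z / ((1 + ‖z‖ ^ 2 : ℝ) : ℂ), ‖z‖ ^ 2 / (1 + ‖z‖ ^ 2))

@[simp] lemma sphereEmb_infty : sphereEmb (∞ : OnePoint ℂ) = (0, 1) := rfl

@[simp] lemma sphereEmb_coe (z : ℂ) : sphereEmb (z : OnePoint ℂ) =
    (z / ((1 + ‖z‖ ^ 2 : ℝ) : ℂ), ‖z‖ ^ 2 / (1 + ‖z‖ ^ 2)) := rfl

@[simp] lemma sphereInv_infty : sphereInv (∞ : OnePoint ℂ) = ((0 : ℂ) : OnePoint ℂ) := rfl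

lemma sphereInv_coe (z : ℂ) : sphereInv (z : OnePoint ℂ) =
    if z = 0 then (∞ : OnePoint ℂ) else ((z⁻¹ : ℂ) : OnePoint ℂ) := rfl

lemma sphereInv_coe_of_ne {z : ℂ} (hz : z ≠ 0) :
    sphereInv (z : OnePoint ℂ) = ((z⁻¹ : ℂ) : OnePoint ℂ) := by
  rw [sphereInv_coe, if_neg hz]

lemma sphereInv_sphereInv (p : OnePoint ℂ) : sphereInv (sphereInv p) = p := by
  induction p using OnePoint.rec with
  | infty => simp [sphereInv_coe]
  | coe z =>
    rcases eq_or_ne z 0 with rfl | hz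
    · simp [sphereInv_coe]
    · rw [sphereInv_coe_of_ne hz, sphereInv_coe_of_ne (inv_ne_zero hz), inv_inv]

/-- The reflection of `ℂ × ℝ` which restricts to the inversion of the sphere. -/
def sphereFlip (p : ℂ × ℝ) : ℂ × ℝ := (conj p.1, 1 - p.2)

lemma continuous_sphereFlip : Continuous sphereFlip :=
  (Complex.continuous_conj.comp continuous_fst).prodMk (continuous_const.sub continuous_snd)

lemma dist_sphereFlip (p q : ℂ × ℝ) : dist (sphereFlip p) (sphereFlip q) = dist p q := by
  rw [Prod.dist_eq, Prod.dist_eq, sphereFlip, sphereFlip, Complex.dist_conj_conj,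
    Real.dist_eq, Real.dist_eq, abs_sub_comm]
  congr 2
  ring

/-- As `sphereFlip` is an isometry, statements on uniform convergence near a pole of the limit
reduce to the case of a finite limit. -/
lemma sphereEmb_sphereInv (p : OnePoint ℂ) : sphereEmb (sphereInv p) = sphereFlip (sphereEmb p) := by
  induction p using OnePoint.rec with
  | infty => simp [sphereFlip]
  | coe z =>
    rcases eq_or_ne z 0 with rfl | hz
    · simp [sphereInv_coe, sphereFlip]
    · rw [sphereInv_coe_of_ne hz, sphereEmb_coe, sphereEmb_coe, sphereFlip]
      have hn : ‖z‖ ≠ 0 := norm_ne_zero_iff.mpr hz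
      have h1 : (1 + ‖z‖ ^ 2 : ℝ) ≠ 0 := by positivity
      have h2 : (1 + ‖z‖ ^ 2 : ℂ) ≠ 0 := by exact_mod_cast h1
      have h3 : (1 + (‖z‖⁻¹) ^ 2 : ℝ) = (1 + ‖z‖ ^ 2) / ‖z‖ ^ 2 := by field_simp; ring
      have hnc : (‖z‖ : ℂ) ≠ 0 := by exact_mod_cast hn
      rw [norm_inv, h3]
      refine Prod.ext ?_ ?_
      · simp only [map_div₀, Complex.conj_ofReal]
        push_cast
        have h4 := Complex.mul_conj' z
        field_simp
        rw [h4]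
      · simp only
        field_simp
        ring

/-- The euclidean distance of the images of two finite points of the sphere. -/
lemma sphereEmb_coe_sub_sq (z w : ℂ) :
    ‖(sphereEmb (z : OnePoint ℂ)).1 - (sphereEmb (w : OnePoint ℂ)).1‖ ^ 2 +
      ((sphereEmb (z : OnePoint ℂ)).2 - (sphereEmb (w : OnePoint ℂ)).2) ^ 2 =
    ‖z - w‖ ^ 2 / ((1 + ‖z‖ ^ 2) * (1 + ‖w‖ ^ 2)) := by
  have hz : (0 : ℝ) < 1 + ‖z‖ ^ 2 := by positivity
  have hw : (0 : ℝ) < 1 + ‖w‖ ^ 2 := by positivity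
  rw [sphereEmb_coe, sphereEmb_coe]
  have e : z / ((1 + ‖z‖ ^ 2 : ℝ) : ℂ) - w / ((1 + ‖w‖ ^ 2 : ℝ) : ℂ) =
      (((1 + ‖w‖ ^ 2 : ℝ) : ℂ) * z - ((1 + ‖z‖ ^ 2 : ℝ) : ℂ) * w) /
        (((1 + ‖z‖ ^ 2) * (1 + ‖w‖ ^ 2) : ℝ) : ℂ) := by
    have h1 : ((1 + ‖z‖ ^ 2 : ℝ) : ℂ) ≠ 0 := by exact_mod_cast hz.ne'
    have h2 : ((1 + ‖w‖ ^ 2 : ℝ) : ℂ) ≠ 0 := by exact_mod_cast hw.ne'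
    rw [Complex.ofReal_mul]
    field_simp
  simp only [e]
  rw [norm_div, Complex.norm_real, Real.norm_eq_abs, abs_of_pos (mul_pos hz hw), div_pow]
  have e2 : ‖((1 + ‖w‖ ^ 2 : ℝ) : ℂ) * z - ((1 + ‖z‖ ^ 2 : ℝ) : ℂ) * w‖ ^ 2 =
      (1 + ‖z‖ ^ 2) * (1 + ‖w‖ ^ 2) * ‖z - w‖ ^ 2 - (‖z‖ ^ 2 - ‖w‖ ^ 2) ^ 2 := by
    simp only [← Complex.normSq_eq_norm_sq]
    rw [Complex.normSq_apply (_ - _), Complex.normSq_apply (z - w)]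
    simp only [Complex.sub_re, Complex.sub_im, Complex.re_ofReal_mul,
      Complex.im_ofReal_mul, Complex.normSq_apply]
    ring
  rw [e2]
  field_simp
  ring

/-- The spherical distance is the arcsine of the euclidean distance of the embedded points. -/
lemma exists_sphericalDist_eq_arcsin (p q : OnePoint ℂ) : ∃ c : ℝ, 0 ≤ c ∧ c ≤ 1 ∧
    sphericalDist p q = Real.arcsin c ∧
    c ^ 2 = ‖(sphereEmb p).1 - (sphereEmb q).1‖ ^ 2 +
      ((sphereEmb p).2 - (sphereEmb q).2) ^ 2 := by
  have hinf : ∀ z : ℂ, 0 ≤ 1 / √(1 + ‖z‖ ^ 2) ∧ 1 / √(1 + ‖z‖ ^ 2) ≤ 1 ∧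
      (1 / √(1 + ‖z‖ ^ 2)) ^ 2 = ‖z / ((1 + ‖z‖ ^ 2 : ℝ) : ℂ)‖ ^ 2 +
        (‖z‖ ^ 2 / (1 + ‖z‖ ^ 2) - 1) ^ 2 := fun z => by
    have h1 : (0 : ℝ) < 1 + ‖z‖ ^ 2 := by positivity
    refine ⟨by positivity, ?_, ?_⟩
    · rw [div_le_one (Real.sqrt_pos.mpr h1)]
      exact Real.one_le_sqrt.mpr (by nlinarith [norm_nonneg z])
    · rw [div_pow, Real.sq_sqrt h1.le, norm_div, Complex.norm_real, Real.norm_eq_abs,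
        abs_of_pos h1]
      field_simp
      ring
  induction p using OnePoint.rec with
  | infty =>
    induction q using OnePoint.rec with
    | infty => exact ⟨0, le_rfl, zero_le_one, by simp [sphericalDist], by simp⟩
    | coe w =>
      obtain ⟨h1, h2, h3⟩ := hinf w
      refine ⟨1 / √(1 + ‖w‖ ^ 2), h1, h2, rfl, ?_⟩
      rw [h3, sphereEmb_infty, sphereEmb_coe, zero_sub, norm_neg]
      ring
  | coe z =>
    induction q using OnePoint.rec with
    | infty =>
      obtain ⟨h1, h2, h3⟩ := hinf z
      refine ⟨1 / √(1 + ‖z‖ ^ 2), h1, h2, rfl, ?_⟩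
      rw [h3, sphereEmb_infty, sphereEmb_coe, sub_zero]
    | coe w =>
      have hz : (0 : ℝ) < 1 + ‖z‖ ^ 2 := by positivity
      have hw : (0 : ℝ) < 1 + ‖w‖ ^ 2 := by positivity
      refine ⟨‖z - w‖ / (√(1 + ‖z‖ ^ 2) * √(1 + ‖w‖ ^ 2)), by positivity, ?_, rfl, ?_⟩
      · rw [div_le_one (by positivity), ← Real.sqrt_mul hz.le]
        apply Real.le_sqrt_of_sq_le
        simp only [← Complex.normSq_eq_norm_sq, Complex.normSq_apply, Complex.sub_re,
          Complex.sub_im]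
        nlinarith [sq_nonneg (1 + z.re * w.re + z.im * w.im),
          sq_nonneg (z.re * w.im - z.im * w.re)]
      · rw [sphereEmb_coe_sub_sq, div_pow, mul_pow, Real.sq_sqrt hz.le, Real.sq_sqrt hw.le]

/-- The chord `c` is at most the arc `arcsin c`, and the distance of `ℂ × ℝ`, being a maximum of
coordinates, is at most the chord. -/
lemma dist_sphereEmb_le_sphericalDist (p q : OnePoint ℂ) :
    dist (sphereEmb p) (sphereEmb q) ≤ sphericalDist p q := by
  obtain ⟨c, h0, h1, hd, hc⟩ := exists_sphericalDist_eq_arcsin p q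
  rw [hd]
  have h2 : c ≤ Real.arcsin c := by
    conv_lhs => rw [← Real.sin_arcsin (by linarith) h1]
    exact Real.sin_le (Real.arcsin_nonneg.mpr h0)
  refine le_trans ?_ h2
  rw [Prod.dist_eq, dist_eq_norm, Real.dist_eq]
  apply max_le
  · refine le_of_sq_le_sq ?_ h0
    nlinarith
  · refine abs_le_of_sq_le_sq ?_ h0
    nlinarith

/-- Jordan's inequality gives `arcsin c ≤ π / 2 * c ≤ 2 * c`. The chord is at most `√2 ≤ 3 / 2`
times the maximum distance. -/
lemma sphericalDist_le_three_mul (p q : OnePoint ℂ) :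
    sphericalDist p q ≤ 3 * dist (sphereEmb p) (sphereEmb q) := by
  obtain ⟨c, h0, h1, hd, hc⟩ := exists_sphericalDist_eq_arcsin p q
  rw [hd]
  have h2 : Real.arcsin c ≤ Real.pi / 2 * c := by
    have h := Real.mul_le_sin (Real.arcsin_nonneg.mpr h0) (Real.arcsin_le_pi_div_two c)
    rw [Real.sin_arcsin (by linarith) h1] at h
    have hpi := Real.pi_pos
    rw [div_mul_eq_mul_div, div_le_iff₀ hpi] at h
    linarith
  set d := dist (sphereEmb p) (sphereEmb q) with hdd
  have hd0 : 0 ≤ d := dist_nonneg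
  have ha : ‖(sphereEmb p).1 - (sphereEmb q).1‖ ≤ d := by
    rw [hdd, Prod.dist_eq, dist_eq_norm]; exact le_max_left _ _
  have hb : |(sphereEmb p).2 - (sphereEmb q).2| ≤ d := by
    rw [hdd, Prod.dist_eq, ← Real.dist_eq]; exact le_max_right _ _
  have hcd : c ^ 2 ≤ 2 * d ^ 2 := by
    rw [hc, ← sq_abs ((sphereEmb p).2 - (sphereEmb q).2)]
    nlinarith [norm_nonneg ((sphereEmb p).1 - (sphereEmb q).1),
      abs_nonneg ((sphereEmb p).2 - (sphereEmb q).2)]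
  have hcd' : c ≤ 3 / 2 * d := by
    apply le_of_sq_le_sq _ (by positivity)
    nlinarith
  have hpi := Real.pi_lt_d2
  have : Real.pi / 2 * c ≤ 2 * (3 / 2 * d) := by
    apply mul_le_mul (by linarith) hcd' h0 (by norm_num)
  linarith

lemma dist_sphereEmb_coe_le (z w : ℂ) :
    dist (sphereEmb (z : OnePoint ℂ)) (sphereEmb (w : OnePoint ℂ)) ≤ ‖z - w‖ := by
  have h := sphereEmb_coe_sub_sq z w
  have h1 : ‖z - w‖ ^ 2 / ((1 + ‖z‖ ^ 2) * (1 + ‖w‖ ^ 2)) ≤ ‖z - w‖ ^ 2 := by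
    apply div_le_self (by positivity)
    nlinarith [sq_nonneg ‖z‖, sq_nonneg ‖w‖, mul_nonneg (sq_nonneg ‖z‖) (sq_nonneg ‖w‖)]
  rw [Prod.dist_eq, dist_eq_norm, Real.dist_eq]
  apply max_le
  · refine le_of_sq_le_sq ?_ (norm_nonneg _)
    nlinarith [sq_nonneg ((sphereEmb (z : OnePoint ℂ)).2 - (sphereEmb (w : OnePoint ℂ)).2)]
  · refine abs_le_of_sq_le_sq ?_ (norm_nonneg _)
    nlinarith [sq_nonneg ‖(sphereEmb (z : OnePoint ℂ)).1 - (sphereEmb (w : OnePoint ℂ)).1‖]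

lemma norm_sub_le_mul_dist_sphereEmb {z w : ℂ} {B : ℝ} (hz : ‖z‖ ≤ B) (hw : ‖w‖ ≤ B) :
    ‖z - w‖ ≤ 2 * (1 + B ^ 2) *
      dist (sphereEmb (z : OnePoint ℂ)) (sphereEmb (w : OnePoint ℂ)) := by
  have h := sphereEmb_coe_sub_sq z w
  set d := dist (sphereEmb (z : OnePoint ℂ)) (sphereEmb (w : OnePoint ℂ)) with hdd
  have hd0 : 0 ≤ d := dist_nonneg
  have ha : ‖(sphereEmb (z : OnePoint ℂ)).1 - (sphereEmb (w : OnePoint ℂ)).1‖ ≤ d := by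
    rw [hdd, Prod.dist_eq, dist_eq_norm]; exact le_max_left _ _
  have hb : |(sphereEmb (z : OnePoint ℂ)).2 - (sphereEmb (w : OnePoint ℂ)).2| ≤ d := by
    rw [hdd, Prod.dist_eq, ← Real.dist_eq]; exact le_max_right _ _
  have ha2 := pow_le_pow_left₀ (norm_nonneg _) ha 2
  have hb2 := pow_le_pow_left₀ (abs_nonneg _) hb 2
  rw [sq_abs] at hb2
  have hz2 : 1 + ‖z‖ ^ 2 ≤ 1 + B ^ 2 := by gcongr
  have hw2 : 1 + ‖w‖ ^ 2 ≤ 1 + B ^ 2 := by gcongr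
  have h1 : ‖z - w‖ ^ 2 ≤ 2 * d ^ 2 * ((1 + B ^ 2) * (1 + B ^ 2)) := by
    have hpos : 0 < (1 + ‖z‖ ^ 2) * (1 + ‖w‖ ^ 2) := by positivity
    have h2 : ‖z - w‖ ^ 2 / ((1 + ‖z‖ ^ 2) * (1 + ‖w‖ ^ 2)) ≤ 2 * d ^ 2 := by linarith
    rw [div_le_iff₀ hpos] at h2
    exact h2.trans (by gcongr)
  refine le_of_sq_le_sq ?_ (by positivity)
  nlinarith [mul_nonneg (sq_nonneg d) (sq_nonneg (1 + B ^ 2))]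

/-- The finite part of a point of the sphere (with `∞ ↦ 0`). -/
def sphereFinite : OnePoint ℂ → ℂ
  | ∞ => 0
  | (z : ℂ) => z

@[simp] lemma sphereFinite_coe (z : ℂ) : sphereFinite (z : OnePoint ℂ) = z := rfl

lemma coe_sphereFinite {p : OnePoint ℂ} (hp : p ≠ (∞ : OnePoint ℂ)) : (sphereFinite p : OnePoint ℂ) = p := by
  induction p using OnePoint.rec with
  | infty => exact absurd rfl hp
  | coe z => rfl

/-- The image of the sphere in `ℂ × ℝ`. -/
lemma range_sphereEmb : range sphereEmb = {p : ℂ × ℝ | ‖p.1‖ ^ 2 + p.2 ^ 2 = p.2} := by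
  ext ⟨ζ, t⟩
  constructor
  · rintro ⟨p, hp⟩
    rw [← hp]
    induction p using OnePoint.rec with
    | infty => simp
    | coe z =>
      have hz : (0 : ℝ) < 1 + ‖z‖ ^ 2 := by positivity
      simp only [sphereEmb_coe, mem_ofPred_eq]
      rw [norm_div, Complex.norm_real, Real.norm_eq_abs, abs_of_pos hz]
      field_simp
  · intro h
    simp only [mem_ofPred_eq] at h
    have ht1 : t ≤ 1 := by nlinarith [sq_nonneg ‖ζ‖]
    rcases ht1.eq_or_lt with rfl | ht
    · have : ‖ζ‖ = 0 := by nlinarith [norm_nonneg ζ]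
      exact ⟨∞, by simp [norm_eq_zero.mp this]⟩
    · have h1 : 0 < 1 - t := by linarith
      have hc : ((1 - t : ℝ) : ℂ) ≠ 0 := by exact_mod_cast h1.ne'
      -- The preimage is the stereographic projection from the pole `(0, 1)`.
      refine ⟨((ζ / ((1 - t : ℝ) : ℂ) : ℂ) : OnePoint ℂ), ?_⟩
      have hn : ‖ζ / ((1 - t : ℝ) : ℂ)‖ ^ 2 = t / (1 - t) := by
        rw [norm_div, Complex.norm_real, Real.norm_eq_abs, abs_of_pos h1, div_pow,
          show ‖ζ‖ ^ 2 = t * (1 - t) by linarith]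
        field_simp
      have hn1 : 1 + t / (1 - t) = (1 - t)⁻¹ := by field_simp; ring
      rw [sphereEmb_coe, hn, hn1, Complex.ofReal_inv]
      refine Prod.ext ?_ ?_
      · simp only
        field_simp
      · simp only
        field_simp

lemma isCompact_range_sphereEmb : IsCompact (range sphereEmb) := by
  rw [range_sphereEmb]
  refine Metric.isCompact_of_isClosed_isBounded ?_ ?_
  · exact isClosed_eq (by fun_prop) (by fun_prop)
  · refine (Metric.isBounded_closedBall (x := (0 : ℂ × ℝ)) (r := 1)).subset fun p hp => ?_
    simp only [mem_ofPred_eq] at hp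
    rw [mem_closedBall_zero_iff, Prod.norm_def, Real.norm_eq_abs]
    have h1 : p.2 ≤ 1 := by nlinarith [sq_nonneg ‖p.1‖]
    have h0 : 0 ≤ p.2 := by nlinarith [sq_nonneg ‖p.1‖, sq_nonneg p.2]
    apply max_le
    · nlinarith [norm_nonneg p.1]
    · rw [abs_of_nonneg h0]; exact h1

lemma sphereEmb_snd_lt_one {p : OnePoint ℂ} (hp : p ≠ (∞ : OnePoint ℂ)) : (sphereEmb p).2 < 1 := by
  induction p using OnePoint.rec with
  | infty => exact absurd rfl hp
  | coe z =>
    rw [sphereEmb_coe, div_lt_one (by positivity)]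
    linarith

/-- The second coordinate is the height on the sphere, equal to `1` only at `∞`. A gap below `1` is
therefore a quantitative bound on finite points. -/
lemma ne_infty_and_norm_le_of_sphereEmb_snd_lt {p : OnePoint ℂ} {δ : ℝ} (hδ : 0 < δ)
    (hp : (sphereEmb p).2 < 1 - δ) : p ≠ (∞ : OnePoint ℂ) ∧ ‖sphereFinite p‖ ≤ 1 + 1 / δ := by
  induction p using OnePoint.rec with
  | infty => simp at hp; linarith
  | coe z =>
    refine ⟨OnePoint.coe_ne_infty z, ?_⟩
    rw [sphereFinite_coe]
    have hz : (0 : ℝ) < 1 + ‖z‖ ^ 2 := by positivity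
    rw [sphereEmb_coe, div_lt_iff₀ hz] at hp
    have h1 : ‖z‖ ^ 2 ≤ 1 / δ := by
      rw [le_div_iff₀ hδ]
      nlinarith
    nlinarith [norm_nonneg z, sq_nonneg (‖z‖ - 1)]

/-! ### Uniform limits of maps analytic into the sphere -/

lemma continuous_sphereEmb_coe : Continuous fun z : ℂ => sphereEmb (z : OnePoint ℂ) := by
  have h : ∀ z : ℂ, (1 + ‖z‖ ^ 2 : ℝ) ≠ 0 := fun z => by positivity
  have h1 : Continuous fun z : ℂ => (1 + ‖z‖ ^ 2 : ℝ) := by fun_prop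
  refine Continuous.prodMk ?_ ?_
  · exact continuous_id.div (Complex.continuous_ofReal.comp h1)
      fun z => Complex.ofReal_ne_zero.mpr (h z)
  · exact (continuous_norm.pow 2).div h1 h

lemma SphereAnalyticAt.continuousAt {f : ℂ → OnePoint ℂ} {z : ℂ} (hf : SphereAnalyticAt f z) :
    ContinuousAt (fun z => sphereEmb (f z)) z := by
  obtain ⟨g, hg, h | h⟩ := hf
  · have := continuous_sphereEmb_coe.continuousAt.comp hg.continuousAt
    exact this.congr (h.mono fun w hw => by simp only [hw, Function.comp])
  · have := (continuous_sphereFlip.comp continuous_sphereEmb_coe).continuousAt.comp hg.continuousAt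
    exact this.congr (h.mono fun w hw => by simp only [hw, Function.comp, sphereEmb_sphereInv])

lemma SphereAnalyticAt.inv {f : ℂ → OnePoint ℂ} {z : ℂ} (hf : SphereAnalyticAt f z) :
    SphereAnalyticAt (fun z => sphereInv (f z)) z := by
  obtain ⟨g, hg, h | h⟩ := hf
  · exact ⟨g, hg, Or.inr (h.mono fun w hw => by simp only [hw])⟩
  · exact ⟨g, hg, Or.inl (h.mono fun w hw => by simp only [hw, sphereInv_sphereInv])⟩

lemma SphereAnalyticAt.analyticAt_sphereFinite {f : ℂ → OnePoint ℂ} {z : ℂ}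
    (hf : SphereAnalyticAt f z) (hz : f z ≠ (∞ : OnePoint ℂ)) : AnalyticAt ℂ (fun z => sphereFinite (f z)) z := by
  obtain ⟨g, hg, h | h⟩ := hf
  · exact hg.congr (h.mono fun w hw => by simp only [hw, sphereFinite_coe])
  · have hgz : g z ≠ 0 := fun h0 => hz (by rw [h.self_of_nhds, h0, sphereInv_coe, if_pos rfl])
    refine (hg.inv hgz).congr ?_
    filter_upwards [h, hg.continuousAt.eventually_ne hgz] with w hw hw0
    rw [hw, sphereInv_coe_of_ne hw0, sphereFinite_coe, Pi.inv_apply]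

/-- Near a point where the limit is finite, uniformly convergent functions are finite and uniformly
bounded. -/
lemma exists_ball_finite_of_tendstoUniformlyOn {f : ℕ → ℂ → OnePoint ℂ} {g : ℂ → OnePoint ℂ}
    {z₀ : ℂ} {r : ℝ} (hr : 0 < r)
    (hfg : TendstoUniformlyOn (fun n z => sphereEmb (f n z)) (fun z => sphereEmb (g z)) atTop
      (Metric.ball z₀ r))
    (hg : ContinuousAt (fun z => sphereEmb (g z)) z₀) (hg0 : g z₀ ≠ (∞ : OnePoint ℂ)) :
    ∃ ρ, 0 < ρ ∧ ρ ≤ r ∧ ∃ B : ℝ,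
      (∀ z ∈ Metric.ball z₀ ρ, g z ≠ (∞ : OnePoint ℂ) ∧ ‖sphereFinite (g z)‖ ≤ B) ∧
      ∀ᶠ n in atTop, ∀ z ∈ Metric.ball z₀ ρ, f n z ≠ (∞ : OnePoint ℂ) ∧ ‖sphereFinite (f n z)‖ ≤ B := by
  set τ := (sphereEmb (g z₀)).2 with hτ
  have hτ1 : τ < 1 := sphereEmb_snd_lt_one hg0
  -- The gap between the height of `g z₀` and the pole is split in three: one part for the
  -- continuity of `g`, one for the uniform convergence, and one left as the final gap.
  set δ := (1 - τ) / 3 with hδ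
  have hδ0 : 0 < δ := by linarith
  obtain ⟨ρ, hρ, hball⟩ := Metric.continuousAt_iff.mp hg δ hδ0
  have hsnd : ∀ p q : ℂ × ℝ, p.2 ≤ q.2 + dist p q := fun p q => by
    have h1 : dist p.2 q.2 ≤ dist p q := by rw [Prod.dist_eq]; exact le_max_right _ _
    have h2 := le_abs_self (p.2 - q.2)
    rw [Real.dist_eq] at h1
    linarith
  have hgb : ∀ z ∈ Metric.ball z₀ (min ρ r), (sphereEmb (g z)).2 < τ + δ := fun z hz => by
    have h1 := hball ((Metric.mem_ball.mp hz).trans_le (min_le_left _ _))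
    have h2 := hsnd (sphereEmb (g z)) (sphereEmb (g z₀))
    linarith
  refine ⟨min ρ r, lt_min hρ hr, min_le_right _ _, 1 + 1 / δ, fun z hz => ?_, ?_⟩
  · refine ne_infty_and_norm_le_of_sphereEmb_snd_lt hδ0 ?_
    linarith [hgb z hz]
  · filter_upwards [Metric.tendstoUniformlyOn_iff.mp hfg δ hδ0] with n hn z hz
    refine ne_infty_and_norm_le_of_sphereEmb_snd_lt hδ0 ?_
    have h1 := hn z (Metric.ball_subset_ball (min_le_right _ _) hz)
    rw [dist_comm] at h1
    have h2 := hsnd (sphereEmb (f n z)) (sphereEmb (g z))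
    linarith [hgb z hz]

lemma differentiableOn_sphereFinite {f : ℂ → OnePoint ℂ} {s : Set ℂ} (hf : SphereAnalyticOn f s)
    (hfin : ∀ z ∈ s, f z ≠ (∞ : OnePoint ℂ)) : DifferentiableOn ℂ (fun z => sphereFinite (f z)) s := fun z hz =>
  ((hf z hz).analyticAt_sphereFinite (hfin z hz)).differentiableAt.differentiableWithinAt

/-- Inversion preserves uniform convergence. -/
lemma tendstoUniformlyOn_sphereInv {f : ℕ → ℂ → OnePoint ℂ} {g : ℂ → OnePoint ℂ} {s : Set ℂ}
    (hfg : TendstoUniformlyOn (fun n z => sphereEmb (f n z)) (fun z => sphereEmb (g z)) atTop s) :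
    TendstoUniformlyOn (fun n z => sphereEmb (sphereInv (f n z)))
      (fun z => sphereEmb (sphereInv (g z))) atTop s := by
  rw [Metric.tendstoUniformlyOn_iff] at hfg ⊢
  simpa only [sphereEmb_sphereInv, dist_sphereFlip] using hfg

/-- **Weierstrass' theorem** for maps into the sphere. -/
theorem sphereAnalyticAt_of_tendstoUniformlyOn {f : ℕ → ℂ → OnePoint ℂ} {g : ℂ → OnePoint ℂ}
    {z₀ : ℂ} {r : ℝ} (hr : 0 < r)
    (hf : ∀ᶠ n in atTop, SphereAnalyticOn (f n) (Metric.ball z₀ r))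
    (hfg : TendstoUniformlyOn (fun n z => sphereEmb (f n z)) (fun z => sphereEmb (g z)) atTop
      (Metric.ball z₀ r)) : SphereAnalyticAt g z₀ := by
  have hz₀ : z₀ ∈ Metric.ball z₀ r := Metric.mem_ball_self hr
  -- the case of a finite limit
  have key : ∀ (f : ℕ → ℂ → OnePoint ℂ) (g : ℂ → OnePoint ℂ),
      (∀ᶠ n in atTop, SphereAnalyticOn (f n) (Metric.ball z₀ r)) →
      TendstoUniformlyOn (fun n z => sphereEmb (f n z)) (fun z => sphereEmb (g z)) atTop
        (Metric.ball z₀ r) → g z₀ ≠ (∞ : OnePoint ℂ) → SphereAnalyticAt g z₀ := by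
    intro f g hf hfg hg0
    have hgc : ContinuousOn (fun z => sphereEmb (g z)) (Metric.ball z₀ r) :=
      hfg.continuousOn (hf.mono fun n hn z hz => (hn z hz).continuousAt.continuousWithinAt).frequently
    obtain ⟨ρ, hρ, hρr, B, hgB, hfB⟩ := exists_ball_finite_of_tendstoUniformlyOn hr hfg
      (hgc.continuousAt (Metric.isOpen_ball.mem_nhds hz₀)) hg0
    have hsub := Metric.ball_subset_ball (x := z₀) hρr
    -- On bounded sets of finite values the euclidean distance is controlled by the spherical one,
    -- so the classical Weierstrass theorem applies.
    have hunif : TendstoUniformlyOn (fun n z => sphereFinite (f n z))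
        (fun z => sphereFinite (g z)) atTop (Metric.ball z₀ ρ) := by
      rw [Metric.tendstoUniformlyOn_iff] at hfg ⊢
      intro ε hε
      have hpos : 0 < 2 * (1 + B ^ 2) := by positivity
      filter_upwards [hfg (ε / (2 * (1 + B ^ 2))) (by positivity), hfB] with n hn hnB z hz
      have h1 := norm_sub_le_mul_dist_sphereEmb (hgB z hz).2 (hnB z hz).2
      rw [coe_sphereFinite (hgB z hz).1, coe_sphereFinite (hnB z hz).1] at h1
      rw [dist_eq_norm]
      refine h1.trans_lt ?_
      rw [mul_comm]
      exact (lt_div_iff₀ hpos).mp (hn z (hsub hz))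
    have hd : DifferentiableOn ℂ (fun z => sphereFinite (g z)) (Metric.ball z₀ ρ) :=
      hunif.tendstoLocallyUniformlyOn.differentiableOn
        (by
          filter_upwards [hf, hfB] with n hn hnB
          exact differentiableOn_sphereFinite (fun z hz => hn z (hsub hz))
            fun z hz => (hnB z hz).1) Metric.isOpen_ball
    refine ⟨fun z => sphereFinite (g z), hd.analyticAt (Metric.ball_mem_nhds _ hρ), Or.inl ?_⟩
    filter_upwards [Metric.ball_mem_nhds z₀ hρ] with z hz
    exact (coe_sphereFinite (hgB z hz).1).symm
  by_cases hg0 : g z₀ = (∞ : OnePoint ℂ)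
  · have h := key (fun n z => sphereInv (f n z)) (fun z => sphereInv (g z))
      (hf.mono fun n hn z hz => (hn z hz).inv) (tendstoUniformlyOn_sphereInv hfg)
      (by rw [hg0]; exact OnePoint.coe_ne_infty _)
    simpa only [sphereInv_sphereInv] using h.inv
  · exact key f g hf hfg hg0

/-- A uniformly convergent sequence of functions analytic into the sphere is locally
equi-Lipschitz. -/
theorem exists_lipschitz_of_tendstoUniformlyOn {f : ℕ → ℂ → OnePoint ℂ} {g : ℂ → OnePoint ℂ}
    {z₀ : ℂ} {r : ℝ} (hr : 0 < r)
    (hf : ∀ᶠ n in atTop, SphereAnalyticOn (f n) (Metric.ball z₀ r))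
    (hfg : TendstoUniformlyOn (fun n z => sphereEmb (f n z)) (fun z => sphereEmb (g z)) atTop
      (Metric.ball z₀ r)) :
    ∃ ρ, 0 < ρ ∧ ∃ B : ℝ, ∀ᶠ n in atTop, ∀ z ∈ Metric.ball z₀ ρ, ∀ w ∈ Metric.ball z₀ ρ,
      dist (sphereEmb (f n z)) (sphereEmb (f n w)) ≤ B * ‖z - w‖ := by
  have hz₀ : z₀ ∈ Metric.ball z₀ r := Metric.mem_ball_self hr
  have key : ∀ (f : ℕ → ℂ → OnePoint ℂ) (g : ℂ → OnePoint ℂ),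
      (∀ᶠ n in atTop, SphereAnalyticOn (f n) (Metric.ball z₀ r)) →
      TendstoUniformlyOn (fun n z => sphereEmb (f n z)) (fun z => sphereEmb (g z)) atTop
        (Metric.ball z₀ r) → g z₀ ≠ (∞ : OnePoint ℂ) →
      ∃ ρ, 0 < ρ ∧ ∃ B : ℝ, ∀ᶠ n in atTop, ∀ z ∈ Metric.ball z₀ ρ, ∀ w ∈ Metric.ball z₀ ρ,
        dist (sphereEmb (f n z)) (sphereEmb (f n w)) ≤ B * ‖z - w‖ := by
    intro f g hf hfg hg0
    have hgc : ContinuousOn (fun z => sphereEmb (g z)) (Metric.ball z₀ r) :=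
      hfg.continuousOn (hf.mono fun n hn z hz => (hn z hz).continuousAt.continuousWithinAt).frequently
    obtain ⟨ρ, hρ, hρr, B, -, hfB⟩ := exists_ball_finite_of_tendstoUniformlyOn hr hfg
      (hgc.continuousAt (Metric.isOpen_ball.mem_nhds hz₀)) hg0
    -- Cauchy's estimate on discs of radius `ρ / 2` about points of the half-size ball, where the
    -- values stay within `2 * B` of the central value.
    refine ⟨ρ / 2, half_pos hρ, 2 * B / (ρ / 2), ?_⟩
    filter_upwards [hf, hfB] with n hn hnB z hz w hw
    have hd : DifferentiableOn ℂ (fun z => sphereFinite (f n z)) (Metric.ball z₀ ρ) :=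
      differentiableOn_sphereFinite
        (fun z hz => hn z (Metric.ball_subset_ball hρr hz)) fun z hz => (hnB z hz).1
    have hbig : Metric.ball z₀ (ρ / 2) ⊆ Metric.ball z₀ ρ :=
      Metric.ball_subset_ball (by linarith)
    have hder : ∀ x ∈ Metric.ball z₀ (ρ / 2),
        ‖deriv (fun z => sphereFinite (f n z)) x‖ ≤ 2 * B / (ρ / 2) := by
      intro x hx
      have hxs : Metric.ball x (ρ / 2) ⊆ Metric.ball z₀ ρ := by
        apply Metric.ball_subset_ball'
        rw [Metric.mem_ball] at hx
        linarith
      refine Complex.norm_deriv_le_div_of_mapsTo_ball (hd.mono hxs) (fun y hy => ?_) (half_pos hρ)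
      rw [Metric.mem_closedBall, dist_eq_norm]
      refine (norm_sub_le _ _).trans ?_
      linarith [(hnB y (hxs hy)).2, (hnB x (hbig hx)).2]
    have hlip := (convex_ball z₀ (ρ / 2)).norm_image_sub_le_of_norm_deriv_le
      (fun x hx => hd.differentiableAt (Metric.isOpen_ball.mem_nhds (hbig hx))) hder hw hz
    have h2 := dist_sphereEmb_coe_le (sphereFinite (f n z)) (sphereFinite (f n w))
    rw [coe_sphereFinite (hnB z (hbig hz)).1, coe_sphereFinite (hnB w (hbig hw)).1] at h2
    exact h2.trans hlip
  by_cases hg0 : g z₀ = (∞ : OnePoint ℂ)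
  · have h := key (fun n z => sphereInv (f n z)) (fun z => sphereInv (g z))
      (hf.mono fun n hn z hz => (hn z hz).inv) (tendstoUniformlyOn_sphereInv hfg)
      (by rw [hg0]; exact OnePoint.coe_ne_infty _)
    simpa only [sphereEmb_sphereInv, dist_sphereFlip] using h
  · exact key f g hf hfg hg0

/-! ### Carathéodory convergence in the plane and sequential compactness -/

/-- Carathéodory convergence to a non-degenerate limit, expressed in the plane. -/
structure PlanarTendsto (U : ℕ → Set ℂ) (u : ℕ → ℂ) (V : Set ℂ) (v : ℂ) : Prop where
  isOpen : IsOpen V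
  isConnected : IsConnected V
  mem : v ∈ V
  base : Tendsto u atTop (𝓝 v)
  compact_subset : ∀ K : Set ℂ, IsCompact K → K ⊆ V → ∀ᶠ m in atTop, K ⊆ U m
  maximal : ∀ N : Set ℂ, IsOpen N → IsConnected N → v ∈ N → (∃ᶠ m in atTop, N ⊆ U m) → N ⊆ V

lemma toSphere_subset_toSphere {S T : Set ℂ} : toSphere S ⊆ toSphere T ↔ S ⊆ T :=
  image_subset_image_iff OnePoint.coe_injective

lemma coe_mem_toSphere {S : Set ℂ} {z : ℂ} : (z : OnePoint ℂ) ∈ toSphere S ↔ z ∈ S :=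
  OnePoint.coe_injective.mem_set_image

lemma infty_notMem_toSphere (S : Set ℂ) : (∞ : OnePoint ℂ) ∉ toSphere S := by
  rintro ⟨z, -, hz⟩
  exact OnePoint.coe_ne_infty z hz

lemma toSphere_preimage {N : Set (OnePoint ℂ)} (hN : (∞ : OnePoint ℂ) ∉ N) :
    toSphere {z : ℂ | (z : OnePoint ℂ) ∈ N} = N := by
  ext p
  induction p using OnePoint.rec with
  | infty => exact iff_of_false (infty_notMem_toSphere _) hN
  | coe z => exact coe_mem_toSphere

lemma isOpen_toSphere {S : Set ℂ} : IsOpen (toSphere S) ↔ IsOpen S :=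
  OnePoint.isOpenEmbedding_coe.isOpen_iff_image_isOpen.symm

lemma isConnected_toSphere {S : Set ℂ} : IsConnected (toSphere S) ↔ IsConnected S :=
  and_congr image_nonempty OnePoint.isOpenEmbedding_coe.isInducing.isPreconnected_image

lemma isCompact_toSphere {S : Set ℂ} : IsCompact (toSphere S) ↔ IsCompact S :=
  OnePoint.isOpenEmbedding_coe.isInducing.isCompact_iff.symm

lemma tendsto_coe_sphere {u : ℕ → ℂ} {v : ℂ} :
    Tendsto (fun m => (u m : OnePoint ℂ)) atTop (𝓝 (v : OnePoint ℂ)) ↔ Tendsto u atTop (𝓝 v) :=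
  (OnePoint.isOpenEmbedding_coe.isInducing.tendsto_nhds_iff).symm

/-- This rules out degenerate limits, because a hyperbolic domain is open. -/
lemma not_isOpen_singleton_sphere (p : OnePoint ℂ) : ¬ IsOpen ({p} : Set (OnePoint ℂ)) := by
  intro h
  have hd : Dense ({(∞ : OnePoint ℂ)}ᶜ : Set (OnePoint ℂ)) := OnePoint.denseRange_coe.mono (by
    rintro _ ⟨z, rfl⟩; exact OnePoint.coe_ne_infty z)
  induction p using OnePoint.rec with
  | infty =>
    obtain ⟨x, hx, hx'⟩ := hd.inter_open_nonempty _ h ⟨∞, rfl⟩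
    exact hx' hx
  | coe z =>
    have : IsOpen ({z} : Set ℂ) := by
      rw [← isOpen_toSphere, toSphere, image_singleton]; exact h
    exact not_isOpen_singleton z this

/-- A non-degenerate limit omits `∞`: otherwise the compact set `{∞}` would lie in some planar
domain `U m`. -/
lemma CaratheodoryTendsto.planar {U : ℕ → Set ℂ} {u : ℕ → ℂ} {V : Set (OnePoint ℂ)}
    {v : OnePoint ℂ} (h : CaratheodoryTendsto (fun m => toSphere (U m))
      (fun m => (u m : OnePoint ℂ)) V v) (hV : V ≠ {v}) :
    ∃ v' : ℂ, v = v' ∧ toSphere {z : ℂ | (z : OnePoint ℂ) ∈ V} = V ∧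
      PlanarTendsto U u {z : ℂ | (z : OnePoint ℂ) ∈ V} v' := by
  have hinf : (∞ : OnePoint ℂ) ∉ V := fun hmem => by
    obtain ⟨m, hm⟩ := (h.compact_subset hV {(∞ : OnePoint ℂ)} isCompact_singleton
      (singleton_subset_iff.mpr hmem)).exists
    exact infty_notMem_toSphere _ (singleton_subset_iff.mp hm)
  have hVs := toSphere_preimage hinf
  set W := {z : ℂ | (z : OnePoint ℂ) ∈ V} with hW
  obtain ⟨hVo, hVc⟩ := h.domain_or_degenerate.resolve_right hV
  have hmem := h.mem
  rw [← hVs] at hmem hVo hVc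
  obtain ⟨v', hv', rfl⟩ := hmem
  refine ⟨v', rfl, hVs, ⟨isOpen_toSphere.mp hVo, isConnected_toSphere.mp hVc, hv',
    tendsto_coe_sphere.mp h.base, fun K hK hKW => ?_, fun N hN hNc hvN hf => ?_⟩⟩
  · have := h.compact_subset hV (toSphere K) (isCompact_toSphere.mpr hK)
      (by rw [← hVs]; exact toSphere_subset_toSphere.mpr hKW)
    exact this.mono fun m hm => toSphere_subset_toSphere.mp hm
  · have := h.maximal (toSphere N) (isOpen_toSphere.mpr hN) (isConnected_toSphere.mpr hNc)
      (coe_mem_toSphere.mpr hvN) (hf.mono fun m hm => toSphere_subset_toSphere.mpr hm)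
    rw [← hVs] at this
    exact toSphere_subset_toSphere.mp this

lemma PlanarTendsto.comp {U : ℕ → Set ℂ} {u : ℕ → ℂ} {V : Set ℂ} {v : ℂ}
    (h : PlanarTendsto U u V v) {φ : ℕ → ℕ} (hφ : StrictMono φ) :
    PlanarTendsto (fun m => U (φ m)) (fun m => u (φ m)) V v where
  isOpen := h.isOpen
  isConnected := h.isConnected
  mem := h.mem
  base := h.base.comp hφ.tendsto_atTop
  compact_subset K hK hKV := hφ.tendsto_atTop.eventually (h.compact_subset K hK hKV)
  maximal N hN hNc hvN hf := h.maximal N hN hNc hvN (hφ.tendsto_atTop.frequently hf)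

lemma PlanarTendsto.caratheodoryTendsto {U : ℕ → Set ℂ} {u : ℕ → ℂ} {V : Set ℂ} {v : ℂ}
    (h : PlanarTendsto U u V v) : CaratheodoryTendsto (fun m => toSphere (U m))
      (fun m => (u m : OnePoint ℂ)) (toSphere V) v where
  mem := coe_mem_toSphere.mpr h.mem
  domain_or_degenerate := Or.inl
    ⟨isOpen_toSphere.mpr h.isOpen, isConnected_toSphere.mpr h.isConnected⟩
  base := tendsto_coe_sphere.mpr h.base
  compact_subset _ K hK hKV := by
    have hK' := toSphere_preimage (fun hi => infty_notMem_toSphere V (hKV hi))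
    rw [← hK'] at hK hKV ⊢
    exact (h.compact_subset _ (isCompact_toSphere.mp hK) (toSphere_subset_toSphere.mp hKV)).mono
      fun m hm => toSphere_subset_toSphere.mpr hm
  maximal N hN hNc hvN hf := by
    obtain ⟨m, hm⟩ := hf.exists
    have hN' := toSphere_preimage (fun hi => infty_notMem_toSphere (U m) (hm hi))
    rw [← hN'] at hN hNc hvN hf ⊢
    exact toSphere_subset_toSphere.mpr (h.maximal _ (isOpen_toSphere.mp hN)
      (isConnected_toSphere.mp hNc) (coe_mem_toSphere.mp hvN)
      (hf.mono fun m hm => toSphere_subset_toSphere.mp hm))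

/-- Only planar `N` need testing, as a set containing `∞` lies in no `U m`. For `v = ∞` the second
hypothesis holds vacuously. -/
lemma caratheodoryTendsto_degenerate {U : ℕ → Set ℂ} {u : ℕ → ℂ} {v : OnePoint ℂ}
    (hu : Tendsto (fun m => (u m : OnePoint ℂ)) atTop (𝓝 v))
    (h : ∀ N : Set ℂ, IsOpen N → (N : Set ℂ).Nonempty → v ∈ toSphere N →
      ¬ ∃ᶠ m in atTop, N ⊆ U m) :
    CaratheodoryTendsto (fun m => toSphere (U m)) (fun m => (u m : OnePoint ℂ)) {v} v where
  mem := rfl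
  domain_or_degenerate := Or.inr rfl
  base := hu
  compact_subset hne := absurd rfl hne
  maximal N hN hNc hvN hf := by
    obtain ⟨m, hm⟩ := hf.exists
    have hN' := toSphere_preimage (fun hi => infty_notMem_toSphere (U m) (hm hi))
    rw [← hN'] at hN hNc hvN hf
    exact absurd (hf.mono fun m hm => toSphere_subset_toSphere.mp hm)
      (h _ (isOpen_toSphere.mp hN) (isConnected_toSphere.mp hNc).nonempty hvN)

/-- Sequential compactness of the set of pointed plane domains, for convergent base points. -/
lemma exists_subseq_caratheodoryTendsto (U : ℕ → Set ℂ) {u : ℕ → ℂ} {v : ℂ}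
    (hu : Tendsto u atTop (𝓝 v)) : ∃ φ : ℕ → ℕ, StrictMono φ ∧ ∃ V : Set (OnePoint ℂ),
      CaratheodoryTendsto (fun m => toSphere (U (φ m))) (fun m => (u (φ m) : OnePoint ℂ)) V v := by
  classical
  let ι := {B : Set ℂ // B ∈ TopologicalSpace.countableBasis ℂ}
  have : Countable ι := (TopologicalSpace.countable_countableBasis ℂ).to_subtype
  -- Compactness of the countable power of `Bool` replaces a diagonal argument: along `φ`, each
  -- basic open set is either eventually contained in the domains or eventually not.
  obtain ⟨χ, φ, hφ, hχ⟩ := CompactSpace.tendsto_subseq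
    (fun (m : ℕ) (B : ι) => (decide ((B : Set ℂ) ⊆ U m) : Bool))
  have hB := TopologicalSpace.isBasis_countableBasis ℂ
  have hdich : ∀ B ∈ TopologicalSpace.countableBasis ℂ, (∃ᶠ m in atTop, B ⊆ U (φ m)) →
      ∀ᶠ m in atTop, B ⊆ U (φ m) := by
    intro B hBm hf
    have h1 := (tendsto_pi_nhds.mp hχ) ⟨B, hBm⟩
    rw [nhds_discrete, tendsto_pure] at h1
    obtain ⟨m, hm1, hm2⟩ := (hf.and_eventually h1).exists
    have h2 : χ ⟨B, hBm⟩ = true := by rw [← hm2]; simpa using hm1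
    filter_upwards [h1] with m hm
    rw [h2] at hm
    simpa using hm
  refine ⟨φ, hφ, ?_⟩
  have huφ : Tendsto (fun m => u (φ m)) atTop (𝓝 v) := hu.comp hφ.tendsto_atTop
  -- `W` contains every open set lying in infinitely many of the selected domains. The limit is the
  -- component of `v` in `W`, or `{v}` when `v ∉ W`.
  set W : Set ℂ := ⋃₀ {B | B ∈ TopologicalSpace.countableBasis ℂ ∧
    ∀ᶠ m in atTop, B ⊆ U (φ m)} with hW
  have hWo : IsOpen W := isOpen_sUnion fun B hBm => hB.isOpen hBm.1
  have hNW : ∀ N : Set ℂ, IsOpen N → (∃ᶠ m in atTop, N ⊆ U (φ m)) → N ⊆ W := by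
    intro N hN hf z hz
    obtain ⟨B, hBm, hzB, hBN⟩ := hB.exists_subset_of_mem_open hz hN
    exact ⟨B, ⟨hBm, hdich B hBm (hf.mono fun m hm => hBN.trans hm)⟩, hzB⟩
  by_cases hv : v ∈ W
  · refine ⟨_, PlanarTendsto.caratheodoryTendsto (V := connectedComponentIn W v)
      ⟨hWo.connectedComponentIn, isConnected_connectedComponentIn_iff.mpr hv,
      mem_connectedComponentIn hv, huφ, fun K hK hKV => ?_, fun N hN hNc hvN hf => ?_⟩⟩
    · obtain ⟨T, hT, hTf, hKT⟩ := hK.elim_finite_subcover_image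
        (b := {B | B ∈ TopologicalSpace.countableBasis ℂ ∧ ∀ᶠ m in atTop, B ⊆ U (φ m)})
        (c := id) (fun B hBm => hB.isOpen hBm.1)
        (by
          have := hKV.trans (connectedComponentIn_subset W v)
          rwa [hW, sUnion_eq_biUnion] at this)
      have : ∀ᶠ m in atTop, ∀ B ∈ T, B ⊆ U (φ m) :=
        (eventually_all_finite hTf).mpr fun B hBT => (hT hBT).2
      filter_upwards [this] with m hm
      exact hKT.trans (iUnion₂_subset hm)
    · exact hNc.isPreconnected.subset_connectedComponentIn hvN (hNW N hN hf)
  · refine ⟨{(v : OnePoint ℂ)}, caratheodoryTendsto_degenerate (tendsto_coe_sphere.mpr huφ)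
      fun N hN _ hvN hf => hv (hNW N hN hf (coe_mem_toSphere.mp hvN))⟩

/-- Every sequence of members of a non-degenerate family has a subsequence which converges to a
hyperbolic plane domain. -/
theorem IsNondegenerateFamily.exists_subseq_planarTendsto {A : Type*} {U : A → Set ℂ} {u : A → ℂ}
    (hU : IsNondegenerateFamily U u) (s : ℕ → A) : ∃ φ : ℕ → ℕ, StrictMono φ ∧
      ∃ (V : Set ℂ) (v : ℂ), PlanarTendsto (fun m => U (s (φ m))) (fun m => u (s (φ m))) V v ∧
        CaratheodoryTendsto (fun m => toSphere (U (s (φ m))))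
          (fun m => (u (s (φ m)) : OnePoint ℂ)) (toSphere V) v ∧
        IsHyperbolicDomain (toSphere V) := by
  -- If the base points tended to `∞`, the domains would converge to the degenerate limit `{∞}`,
  -- which is not hyperbolic.
  have hfr : ∃ R : ℝ, ∃ᶠ m in atTop, u (s m) ∈ Metric.closedBall (0 : ℂ) R := by
    by_contra! hcon
    have ht : Tendsto (fun m => u (s m)) atTop (cocompact ℂ) := by
      rw [← Metric.cobounded_eq_cocompact, ← tendsto_norm_atTop_iff_cobounded, tendsto_atTop]
      intro R
      have := hcon R
      refine this.mono fun m hm => ?_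
      rw [mem_closedBall_zero_iff, not_le] at hm
      exact hm.le
    have ht' : Tendsto (fun m => (u (s m) : OnePoint ℂ)) atTop (𝓝 ∞) := by
      have := (OnePoint.tendsto_coe_infty (X := ℂ))
      rw [← coclosedCompact_eq_cocompact] at ht
      exact this.comp ht
    exact not_isOpen_singleton_sphere _ (hU.limit_hyperbolic s {(∞ : OnePoint ℂ)} ∞
      (caratheodoryTendsto_degenerate ht'
        fun N _ _ hi => absurd hi (infty_notMem_toSphere N))).1
  obtain ⟨R, hR⟩ := hfr
  obtain ⟨v, -, φ, hφ, hv⟩ := tendsto_subseq_of_frequently_bounded Metric.isBounded_closedBall hR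
  obtain ⟨ψ, hψ, V, hV⟩ := exists_subseq_caratheodoryTendsto (fun m => U (s (φ m))) hv
  have hhyp := hU.limit_hyperbolic (fun m => s (φ (ψ m))) V v hV
  have hne : V ≠ {(v : OnePoint ℂ)} := fun h => not_isOpen_singleton_sphere _ (h ▸ hhyp.1)
  obtain ⟨v', hv', hVs, hp⟩ := hV.planar hne
  refine ⟨φ ∘ ψ, hφ.comp hψ, _, v', hp, ?_, ?_⟩
  · rw [hVs, ← hv']; exact hV
  · rw [hVs]; exact hhyp

/-! ### Omitted points of converging domains -/

/-- `V` omits at least two finite points. If its frontier were a single point `p`, then `V` and its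
exterior would cover the connected set `ℂ \ {p}`, so `V` would omit nothing but `p`. -/
lemma exists_ne_mem_frontier {V : Set ℂ} (h : IsHyperbolicDomain (toSphere V)) :
    ∃ p ∈ frontier V, ∃ q ∈ frontier V, p ≠ q := by
  obtain ⟨hVo, hVc, hcard⟩ := h
  rw [isOpen_toSphere] at hVo
  rw [isConnected_toSphere] at hVc
  have hcompl : (toSphere V)ᶜ ⊆ insert (∞ : OnePoint ℂ) (toSphere Vᶜ) := by
    intro p hp
    induction p using OnePoint.rec with
    | infty => exact mem_insert _ _
    | coe z => exact Or.inr (coe_mem_toSphere.mpr fun hz => hp (coe_mem_toSphere.mpr hz))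
  have h1 : 1 < Vᶜ.encard := by
    by_contra! hle
    have h2 := hcard.trans ((encard_le_encard hcompl).trans (encard_insert_le _ _))
    rw [toSphere, OnePoint.coe_injective.encard_image] at h2
    have h3 : (3 : ℕ∞) ≤ 1 + 1 := h2.trans (by gcongr)
    norm_num at h3
  obtain ⟨a, b, ha, hb, hab⟩ := one_lt_encard_iff.mp h1
  obtain ⟨p, hp⟩ : (frontier V).Nonempty :=
    nonempty_frontier_iff.mpr ⟨hVc.nonempty, fun h => ha (h ▸ mem_univ a)⟩
  refine ⟨p, hp, ?_⟩
  by_contra! hcon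
  have hpV : p ∉ V := fun hmem => by
    rw [hVo.frontier_eq] at hp
    exact hp.2 hmem
  have hsub : ({p}ᶜ : Set ℂ) ⊆ V := by
    refine IsPreconnected.subset_left_of_subset_union hVo isClosed_closure.isOpen_compl
      (disjoint_compl_right.mono_left subset_closure) (fun z hz => ?_) ?_
      (isConnected_compl_singleton_of_one_lt_rank (by simp) p).isPreconnected
    · by_cases hzV : z ∈ V
      · exact Or.inl hzV
      · refine Or.inr fun hzc => hz ?_
        exact (hcon z (by rw [hVo.frontier_eq]; exact ⟨hzc, hzV⟩)).symm
    · obtain ⟨z, hz⟩ := hVc.nonempty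
      exact ⟨z, fun h => hpV (h ▸ hz), hz⟩
  refine hab ?_
  have ha' : a = p := by by_contra h; exact ha (hsub h)
  have hb' : b = p := by by_contra h; exact hb (hsub h)
  rw [ha', hb']

/-- Attaching preconnected sets to a preconnected set keeps it preconnected. -/
lemma isPreconnected_union_biUnion {α ι : Type*} [TopologicalSpace α] {P : Set α} {I : Set ι}
    {B : ι → Set α} (hP : IsPreconnected P) (hB : ∀ i ∈ I, IsPreconnected (B i))
    (hPB : ∀ i ∈ I, (P ∩ B i).Nonempty) : IsPreconnected (P ∪ ⋃ i ∈ I, B i) := by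
  rcases P.eq_empty_or_nonempty with rfl | ⟨x, hx⟩
  · have : ⋃ i ∈ I, B i = ∅ := by
      simp only [iUnion_eq_empty]
      intro i hi
      simpa using hPB i hi
    rw [this, union_empty]
    exact hP
  · refine isPreconnected_of_forall x fun y hy => ?_
    rcases hy with hy | hy
    · exact ⟨P, subset_union_left, hx, hy, hP⟩
    · obtain ⟨i, hi, hyi⟩ := mem_iUnion₂.mp hy
      exact ⟨P ∪ B i, union_subset_union_right _ (subset_biUnion_of_mem hi), Or.inl hx, Or.inr hyi,
        hP.union' (hPB i hi) (hB i hi)⟩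

/-- Otherwise a ball about `p`, together with a thin neighbourhood of a path in `V` from `v` into
that ball, is a connected open set lying in infinitely many `U m`. Maximality puts it in `V`,
although `p ∉ V`. -/
lemma PlanarTendsto.eventually_not_ball_subset {U : ℕ → Set ℂ} {u : ℕ → ℂ} {V : Set ℂ} {v : ℂ}
    (h : PlanarTendsto U u V v) {p : ℂ} (hp : p ∈ frontier V) {ε : ℝ} (hε : 0 < ε) :
    ∀ᶠ m in atTop, ¬ Metric.ball p ε ⊆ U m := by
  by_contra hcon
  have hfr : ∃ᶠ m in atTop, Metric.ball p ε ⊆ U m := by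
    rwa [Filter.Frequently]
  rw [h.isOpen.frontier_eq] at hp
  obtain ⟨w, hwV, hw⟩ := Metric.mem_closure_iff.mp hp.1 ε hε
  obtain ⟨γ, hγ⟩ := (h.isOpen.isConnected_iff_isPathConnected.mp h.isConnected).joinedIn v h.mem w hwV
  have hrV : range γ ⊆ V := range_subset_iff.mpr hγ
  have hrc : IsCompact (range γ) := isCompact_range γ.continuous
  obtain ⟨δ, hδ, hδV⟩ := hrc.exists_cthickening_subset_open h.isOpen hrV
  have hev := h.compact_subset _ hrc.cthickening hδV
  have hvr : v ∈ range γ := ⟨0, γ.source⟩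
  have hwr : w ∈ range γ := ⟨1, γ.target⟩
  have hsubU : ∀ U : Set ℂ, Metric.cthickening δ (range γ) ⊆ U → Metric.ball p ε ⊆ U →
      (range γ ∪ Metric.ball p ε) ∪ ⋃ x ∈ range γ, Metric.ball x δ ⊆ U := by
    intro U h1 h2
    refine union_subset (union_subset ((Metric.self_subset_cthickening _).trans h1) h2)
      (iUnion₂_subset fun x hx => ?_)
    exact (Metric.ball_subset_thickening hx δ).trans
      ((Metric.thickening_subset_cthickening _ _).trans h1)
  have hN := h.maximal ((range γ ∪ Metric.ball p ε) ∪ ⋃ x ∈ range γ, Metric.ball x δ) ?_ ?_ ?_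
    ((hfr.and_eventually hev).mono fun m hm => hsubU _ hm.2 hm.1)
  · exact hp.2 (hN (Or.inl (Or.inr (Metric.mem_ball_self hε))))
  · have : (range γ ∪ Metric.ball p ε) ∪ ⋃ x ∈ range γ, Metric.ball x δ =
        Metric.ball p ε ∪ ⋃ x ∈ range γ, Metric.ball x δ := by
      apply Subset.antisymm
      · refine union_subset (union_subset (fun x hx => Or.inr ?_) subset_union_left)
          subset_union_right
        exact mem_iUnion₂.mpr ⟨x, hx, Metric.mem_ball_self hδ⟩
      · exact union_subset_union_left _ subset_union_right
    rw [this]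
    exact Metric.isOpen_ball.union (isOpen_biUnion fun _ _ => Metric.isOpen_ball)
  · refine ⟨⟨v, Or.inl (Or.inl hvr)⟩, isPreconnected_union_biUnion ?_ ?_ ?_⟩
    · refine IsPreconnected.union' ⟨w, hwr, ?_⟩ (isPreconnected_range γ.continuous)
        (convex_ball p ε).isPreconnected
      rw [Metric.mem_ball, dist_comm]; exact hw
    · exact fun x _ => (convex_ball x δ).isPreconnected
    · exact fun x hx => ⟨x, Or.inl hx, Metric.mem_ball_self hδ⟩
  · exact Or.inl (Or.inl hvr)

/-- Domains converging to a hyperbolic domain omit two uniformly separated, uniformly bounded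
points. -/
lemma PlanarTendsto.exists_omitted_pair {U : ℕ → Set ℂ} {u : ℕ → ℂ} {V : Set ℂ} {v : ℂ}
    (h : PlanarTendsto U u V v) (hV : IsHyperbolicDomain (toSphere V)) :
    ∃ ε T : ℝ, 0 < ε ∧ 0 < T ∧ ∀ᶠ m in atTop, ∃ a b : ℂ, a ∉ U m ∧ b ∉ U m ∧ 2 * ε ≤ ‖b - a‖ ∧
      ‖a - v‖ ≤ T ∧ ‖b - v‖ ≤ T := by
  obtain ⟨p, hp, q, hq, hpq⟩ := exists_ne_mem_frontier hV
  have hd : 0 < ‖q - p‖ := norm_pos_iff.mpr (sub_ne_zero.mpr hpq.symm)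
  -- Points within `ε` of `p` and of `q` are still at least `2 * ε` apart.
  set ε := ‖q - p‖ / 4 with hε
  have hε0 : 0 < ε := by positivity
  refine ⟨ε, ‖p - v‖ + ‖q - v‖ + ε, hε0, by positivity, ?_⟩
  filter_upwards [h.eventually_not_ball_subset hp hε0, h.eventually_not_ball_subset hq hε0]
    with m hm1 hm2
  obtain ⟨a, ha, haU⟩ := not_subset.mp hm1
  obtain ⟨b, hb, hbU⟩ := not_subset.mp hm2
  rw [Metric.mem_ball, dist_eq_norm] at ha hb
  refine ⟨a, b, haU, hbU, ?_, ?_, ?_⟩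
  · have h1 : ‖q - p‖ ≤ ‖b - q‖ + ‖b - a‖ + ‖a - p‖ := by
      have : q - p = -(b - q) + (b - a) + (a - p) := by ring
      rw [this]
      exact (norm_add₃_le).trans (by rw [norm_neg])
    linarith
  · have h1 : ‖a - v‖ ≤ ‖a - p‖ + ‖p - v‖ := norm_sub_le_norm_sub_add_norm_sub _ _ _
    linarith [norm_nonneg (q - v)]
  · have h1 : ‖b - v‖ ≤ ‖b - q‖ + ‖q - v‖ := norm_sub_le_norm_sub_add_norm_sub _ _ _
    linarith [norm_nonneg (p - v)]

/-! ### Hyperbolic balls about the base points -/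

/-- The omitted point of a short path is not far away. -/
lemma exists_path_norm_sub_le {s S T R : ℝ} (hs : 0 < s) :
    ∃ L : ℝ, 0 < L ∧ ∀ (U : Set ℂ) (a b : ℂ), a ∉ U → b ∉ U → s ≤ ‖b - a‖ → ‖b - a‖ ≤ S →
      ∀ γ : ℝ → ℂ, ContDiff ℝ 1 γ → (∀ t ∈ Icc (0 : ℝ) 1, γ t ∈ U) →
      hyperbolicLength U γ ≤ ENNReal.ofReal R → ‖γ 0 - a‖ ≤ T →
      ∀ t ∈ Icc (0 : ℝ) 1, ‖γ t - a‖ ≤ L := by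
  obtain ⟨C, hC1, hC⟩ := omitHeight_lipschitz
  -- The constant is the radius at which `omitHeight` reaches its largest possible initial value
  -- plus the allowed increase. The maxima keep it positive and allow `R` to be negative.
  refine ⟨max S 1 * Real.exp (Real.sinh (Real.arsinh (Real.log (T / s)) + C * max R 0)),
    by positivity, fun U a b ha hb hsab hSab γ hγ hγU hl h0 t ht => ?_⟩
  have hba : 0 < ‖b - a‖ := hs.trans_le hsab
  have hab : a ≠ b := fun h => by rw [h, sub_self, norm_zero] at hba; exact hba.false
  have hpos : ∀ t ∈ Icc (0 : ℝ) 1, 0 < ‖γ t - a‖ := fun t ht =>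
    norm_pos_iff.mpr (sub_ne_zero.mpr fun h => ha (h ▸ hγU t ht))
  have h1 : |omitHeight a b (γ t) - omitHeight a b (γ 0)| ≤ C * max R 0 := by
    have := (hC U a b ha hb hab γ hγ hγU t ht).trans (mul_le_mul_right
      (hl.trans (ENNReal.ofReal_le_ofReal (le_max_left R 0))) _)
    rw [← ENNReal.ofReal_mul (by linarith)] at this
    exact (ENNReal.ofReal_le_ofReal_iff (by positivity)).mp this
  have h00 := hpos 0 (by simp)
  have h2 : omitHeight a b (γ 0) ≤ Real.arsinh (Real.log (T / s)) := by
    apply Real.arsinh_le_arsinh.mpr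
    apply Real.log_le_log (by positivity)
    exact div_le_div₀ (by linarith) h0 hs hsab
  have h3 : omitHeight a b (γ t) ≤ Real.arsinh (Real.log (T / s)) + C * max R 0 := by
    linarith [le_abs_self (omitHeight a b (γ t) - omitHeight a b (γ 0))]
  have h4 : Real.log (‖γ t - a‖ / ‖b - a‖) ≤
      Real.sinh (Real.arsinh (Real.log (T / s)) + C * max R 0) := by
    rw [← Real.sinh_arsinh (Real.log (‖γ t - a‖ / ‖b - a‖))]
    exact Real.sinh_le_sinh.mpr h3
  rw [Real.log_le_iff_le_exp (div_pos (hpos t ht) hba), div_le_iff₀ hba] at h4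
  rw [mul_comm]
  refine h4.trans ?_
  gcongr
  exact hSab.trans (le_max_left _ _)

/-- A short path does not come close to an omitted point. -/
lemma exists_le_path_norm_sub {s S τ R : ℝ} (hs : 0 < s) (hτ : 0 < τ) :
    ∃ δ : ℝ, 0 < δ ∧ ∀ (U : Set ℂ) (a b : ℂ), a ∉ U → b ∉ U → s ≤ ‖b - a‖ → ‖b - a‖ ≤ S →
      ∀ γ : ℝ → ℂ, ContDiff ℝ 1 γ → (∀ t ∈ Icc (0 : ℝ) 1, γ t ∈ U) →
      hyperbolicLength U γ ≤ ENNReal.ofReal R → τ ≤ ‖γ 0 - a‖ →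
      ∀ t ∈ Icc (0 : ℝ) 1, δ ≤ ‖γ t - a‖ := by
  obtain ⟨C, hC1, hC⟩ := omitHeight_lipschitz
  -- Here the radius is read off from the smallest possible initial height minus the allowed
  -- decrease.
  refine ⟨s * Real.exp (Real.sinh (Real.arsinh (Real.log (τ / S)) - C * max R 0)),
    by positivity, fun U a b ha hb hsab hSab γ hγ hγU hl h0 t ht => ?_⟩
  have hba : 0 < ‖b - a‖ := hs.trans_le hsab
  have hab : a ≠ b := fun h => by rw [h, sub_self, norm_zero] at hba; exact hba.false
  have hpos : ∀ t ∈ Icc (0 : ℝ) 1, 0 < ‖γ t - a‖ := fun t ht =>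
    norm_pos_iff.mpr (sub_ne_zero.mpr fun h => ha (h ▸ hγU t ht))
  have h1 : |omitHeight a b (γ t) - omitHeight a b (γ 0)| ≤ C * max R 0 := by
    have := (hC U a b ha hb hab γ hγ hγU t ht).trans (mul_le_mul_right
      (hl.trans (ENNReal.ofReal_le_ofReal (le_max_left R 0))) _)
    rw [← ENNReal.ofReal_mul (by linarith)] at this
    exact (ENNReal.ofReal_le_ofReal_iff (by positivity)).mp this
  have hS : 0 < S := hba.trans_le hSab
  have h2 : Real.arsinh (Real.log (τ / S)) ≤ omitHeight a b (γ 0) := by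
    apply Real.arsinh_le_arsinh.mpr
    apply Real.log_le_log (by positivity)
    exact div_le_div₀ (norm_nonneg _) h0 hba hSab
  have h3 : Real.arsinh (Real.log (τ / S)) - C * max R 0 ≤ omitHeight a b (γ t) := by
    linarith [neg_abs_le (omitHeight a b (γ t) - omitHeight a b (γ 0))]
  have h4 : Real.sinh (Real.arsinh (Real.log (τ / S)) - C * max R 0) ≤
      Real.log (‖γ t - a‖ / ‖b - a‖) := by
    rw [← Real.sinh_arsinh (Real.log (‖γ t - a‖ / ‖b - a‖))]
    exact Real.sinh_le_sinh.mpr h3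
  rw [Real.le_log_iff_exp_le (div_pos (hpos t ht) hba), le_div_iff₀ hba] at h4
  rw [mul_comm]
  refine le_trans ?_ h4
  gcongr

lemma PlanarTendsto.exists_ball_subset {U : ℕ → Set ℂ} {u : ℕ → ℂ} {V : Set ℂ} {v : ℂ}
    (h : PlanarTendsto U u V v) : ∃ τ, 0 < τ ∧ ∀ᶠ m in atTop, ‖u m - v‖ < τ ∧
      Metric.ball v (2 * τ) ⊆ U m := by
  obtain ⟨r, hr, hrV⟩ := Metric.isOpen_iff.mp h.isOpen v h.mem
  refine ⟨r / 4, by positivity, ?_⟩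
  have h1 := h.compact_subset (Metric.closedBall v (r / 2)) (isCompact_closedBall _ _)
    ((Metric.closedBall_subset_ball (by linarith)).trans hrV)
  have h2 := Metric.tendsto_nhds.mp h.base (r / 4) (by positivity)
  filter_upwards [h1, h2] with m hm1 hm2
  refine ⟨by rwa [dist_eq_norm] at hm2, (Metric.ball_subset_closedBall.trans ?_).trans hm1⟩
  exact Metric.closedBall_subset_closedBall (by linarith)

/-- Short paths from the base points stay in a bounded region, away from the omitted points. -/
lemma PlanarTendsto.exists_path_bounds {U : ℕ → Set ℂ} {u : ℕ → ℂ} {V : Set ℂ} {v : ℂ}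
    (h : PlanarTendsto U u V v) (hV : IsHyperbolicDomain (toSphere V)) (R : ℝ) :
    ∃ L δ : ℝ, 0 < L ∧ 0 < δ ∧ ∀ᶠ m in atTop, ∀ γ : ℝ → ℂ, ContDiff ℝ 1 γ →
      (∀ t ∈ Icc (0 : ℝ) 1, γ t ∈ U m) → γ 0 = u m →
      hyperbolicLength (U m) γ ≤ ENNReal.ofReal R → ∀ t ∈ Icc (0 : ℝ) 1,
        ‖γ t - v‖ ≤ L ∧ Metric.ball (γ t) δ ⊆ U m := by
  obtain ⟨ε, T, hε, hT, hpair⟩ := h.exists_omitted_pair hV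
  obtain ⟨τ, hτ, hbase⟩ := h.exists_ball_subset
  obtain ⟨L₀, hL₀, hL⟩ := exists_path_norm_sub_le (s := 2 * ε) (S := 2 * T) (T := τ + T) (R := R)
    (by positivity)
  set L := L₀ + T with hLdef
  obtain ⟨δ, hδ, hδp⟩ := exists_le_path_norm_sub (s := ε) (S := T + (L + 1)) (R := R) hε hτ
  refine ⟨L, min δ 1, by positivity, lt_min hδ one_pos, ?_⟩
  filter_upwards [hpair, hbase] with m ⟨a, b, ha, hb, hab, haT, hbT⟩ ⟨hum, hball⟩ γ hγ hγU hγ0 hl t ht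
  have hbound : ‖γ t - v‖ ≤ L := by
    have h1 : ‖b - a‖ ≤ 2 * T := by
      have := norm_sub_le_norm_sub_add_norm_sub b v a
      rw [norm_sub_rev v a] at this
      linarith
    have h2 : ‖γ 0 - a‖ ≤ τ + T := by
      have := norm_sub_le_norm_sub_add_norm_sub (γ 0) v a
      rw [norm_sub_rev v a, hγ0] at this
      rw [hγ0]
      linarith
    have h3 := hL (U m) a b ha hb hab h1 γ hγ hγU hl h2 t ht
    have := norm_sub_le_norm_sub_add_norm_sub (γ t) a v
    linarith
  -- Any omitted point `c` close to the path can itself serve as the first point of an omitted pair.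
  -- The cut-off `min δ 1` keeps `c` within `L + 1` of `v`, so the pair has bounded separation.
  refine ⟨hbound, fun c hc => ?_⟩
  by_contra hcU
  rw [Metric.mem_ball, dist_eq_norm, norm_sub_rev] at hc
  have hcv : ‖c - v‖ ≤ L + 1 := by
    have := norm_sub_le_norm_sub_add_norm_sub c (γ t) v
    rw [norm_sub_rev c (γ t)] at this
    linarith [min_le_right δ 1]
  have h0c : τ ≤ ‖γ 0 - c‖ := by
    by_contra! hlt
    refine hcU (hball ?_)
    rw [Metric.mem_ball, dist_eq_norm]
    have := norm_sub_le_norm_sub_add_norm_sub c (γ 0) v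
    rw [norm_sub_rev c (γ 0), hγ0] at this
    rw [hγ0] at hlt
    linarith
  have hfar : ∀ e : ℂ, e ∉ U m → ‖e - v‖ ≤ T → ε ≤ ‖e - c‖ → False := by
    intro e he heT hec
    have h1 : ‖e - c‖ ≤ T + (L + 1) := by
      have := norm_sub_le_norm_sub_add_norm_sub e v c
      rw [norm_sub_rev v c] at this
      linarith
    have := hδp (U m) c e hcU he hec h1 γ hγ hγU hl h0c t ht
    linarith [min_le_left δ 1]
  -- As `‖b - a‖ ≥ 2 * ε`, at least one of `a` and `b` is at distance `≥ ε` from `c` and serves as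
  -- its partner.
  rcases le_total ε ‖a - c‖ with h1 | h1
  · exact hfar a ha haT h1
  · refine hfar b hb hbT ?_
    have := norm_sub_le_norm_sub_add_norm_sub b c a
    rw [norm_sub_rev c a] at this
    linarith

/-- With `y = ‖z - a‖` and `d = ‖b - a‖`, the quantity `y * (1 + |log (y / d)|)` stays bounded as `y
→ 0`, because `x * |log x| ≤ 1 + x ^ 2`. Hence no lower bound on the distance to `a` is needed. -/
lemma exists_hyperbolicDensity_lower_bound {s S L : ℝ} (hs : 0 < s) (hL : 0 < L) :
    ∃ c : ℝ, 0 < c ∧ ∀ (U : Set ℂ) (a b : ℂ), a ∉ U → b ∉ U → s ≤ ‖b - a‖ → ‖b - a‖ ≤ S →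
      ∀ z ∈ U, ‖z - a‖ ≤ L → ENNReal.ofReal c ≤ hyperbolicDensity U z := by
  obtain ⟨C, hC1, hC⟩ := hyperbolicDensity_lower_bound
  refine ⟨1 / (C * (L + |S| + L ^ 2 / s)), by positivity,
    fun U a b ha hb hsab hSab z hz hzL => ?_⟩
  have hba : 0 < ‖b - a‖ := hs.trans_le hsab
  have hab : a ≠ b := fun h => by rw [h, sub_self, norm_zero] at hba; exact hba.false
  have hza : 0 < ‖z - a‖ := norm_pos_iff.mpr (sub_ne_zero.mpr fun h => ha (h ▸ hz))
  refine le_trans (ENNReal.ofReal_le_ofReal ?_) (hC U a b ha hb hab z hz)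
  have key : ∀ x : ℝ, 0 < x → x * |Real.log x| ≤ 1 + x ^ 2 := by
    intro x hx
    have h1 := Real.log_le_sub_one_of_pos hx
    have h2 := Real.one_sub_inv_le_log_of_pos hx
    have h3 : x * x⁻¹ = 1 := mul_inv_cancel₀ hx.ne'
    rcases abs_cases (Real.log x) with ⟨h, -⟩ | ⟨h, -⟩ <;> rw [h] <;> nlinarith
  have hx := key (‖z - a‖ / ‖b - a‖) (by positivity)
  set y := ‖z - a‖ with hy
  set d := ‖b - a‖ with hd
  have h1 : y * |Real.log (y / d)| ≤ d + y ^ 2 / d := by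
    have : y * |Real.log (y / d)| = d * (y / d * |Real.log (y / d)|) := by field_simp
    rw [this]
    calc d * (y / d * |Real.log (y / d)|) ≤ d * (1 + (y / d) ^ 2) := by gcongr
      _ = d + y ^ 2 / d := by field_simp
  have h2 : y ^ 2 / d ≤ L ^ 2 / s := by gcongr
  have h3 : d ≤ |S| := hSab.trans (le_abs_self S)
  have h4 : y * (1 + |Real.log (y / d)|) ≤ L + |S| + L ^ 2 / s := by
    rw [mul_add, mul_one]; linarith
  apply one_div_le_one_div_of_le (by positivity)
  gcongr

/-- On hyperbolic balls about the base points, the hyperbolic distance of a convergent sequence of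
domains dominates the euclidean distance. -/
lemma PlanarTendsto.exists_mul_dist_le_hyperbolicDist {U : ℕ → Set ℂ} {u : ℕ → ℂ} {V : Set ℂ}
    {v : ℂ} (h : PlanarTendsto U u V v) (hV : IsHyperbolicDomain (toSphere V)) (R : ℝ≥0) :
    ∃ c : ℝ, 0 < c ∧ ∀ᶠ m in atTop, ∀ z w : ℂ, hyperbolicDist (U m) (u m) z ≤ R →
      hyperbolicDist (U m) (u m) w ≤ R →
      ENNReal.ofReal (c * ‖z - w‖) ≤ hyperbolicDist (U m) z w := by
  obtain ⟨ε, T, hε, hT, hpair⟩ := h.exists_omitted_pair hV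
  obtain ⟨L, δ, hL, hδ, hpath⟩ := h.exists_path_bounds hV (R + 1)
  obtain ⟨L₁, hL₁, hlen⟩ := exists_path_norm_sub_le (s := 2 * ε) (S := 2 * T) (T := L + T) (R := 1)
    (by positivity)
  obtain ⟨c, hc, hdens⟩ := exists_hyperbolicDensity_lower_bound (s := 2 * ε) (S := 2 * T)
    (by positivity) hL₁
  -- The two constants serve two kinds of paths. Length at least `1` already dominates `‖z - w‖ / (2
  -- * L)`, since both points lie within `L` of `v`. A shorter path stays in a bounded region, where
  -- the density is at least `c`.
  refine ⟨min c (1 / (2 * L)), by positivity, ?_⟩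
  filter_upwards [hpair, hpath] with m ⟨a, b, ha, hb, hab, haT, hbT⟩ hpm z w hz hw
  have hbd : ∀ z, hyperbolicDist (U m) (u m) z ≤ R → ‖z - v‖ ≤ L := by
    intro z hz
    -- The distance is an infimum that need not be attained, hence a path of length below `R + 1`.
    obtain ⟨γ, hγ, hγU, hγ0, hγ1, hl⟩ := exists_path_of_hyperbolicDist_lt
      (r := ENNReal.ofReal (R + 1)) (hz.trans_lt (by
        rw [← ENNReal.ofReal_coe_nnreal]
        exact (ENNReal.ofReal_lt_ofReal_iff (by positivity)).mpr (by linarith)))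
    rw [← hγ1]
    exact (hpm γ hγ hγU hγ0 hl.le 1 (by simp)).1
  have hzL := hbd z hz
  have hwL := hbd w hw
  have hzw : ‖z - w‖ ≤ 2 * L := by
    have := norm_sub_le_norm_sub_add_norm_sub z v w
    rw [norm_sub_rev v w] at this
    linarith
  refine le_iInf₂ fun γ ⟨hγ, hγU, hγ0, hγ1⟩ => ?_
  change _ ≤ hyperbolicLength (U m) γ
  rcases le_total (ENNReal.ofReal 1) (hyperbolicLength (U m) γ) with hl | hl
  · refine le_trans (ENNReal.ofReal_le_ofReal ?_) hl
    calc min c (1 / (2 * L)) * ‖z - w‖ ≤ 1 / (2 * L) * (2 * L) := by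
          gcongr
          exact min_le_right _ _
      _ = 1 := by field_simp
  · have h1 : ‖b - a‖ ≤ 2 * T := by
      have := norm_sub_le_norm_sub_add_norm_sub b v a
      rw [norm_sub_rev v a] at this
      linarith
    have h2 : ‖γ 0 - a‖ ≤ L + T := by
      have := norm_sub_le_norm_sub_add_norm_sub (γ 0) v a
      rw [norm_sub_rev v a, hγ0] at this
      rw [hγ0]
      linarith
    have h3 := hlen (U m) a b ha hb hab h1 γ hγ hγU hl h2
    have h4 := mul_dist_le_hyperbolicLength (U := U m) hγ (c := ENNReal.ofReal c)
      ENNReal.ofReal_ne_top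
      (fun t ht => hdens (U m) a b ha hb hab h1 (γ t) (hγU t ht) (h3 t ht))
    rw [hγ0, hγ1, ← ofReal_norm, ← ENNReal.ofReal_mul hc.le, norm_sub_rev] at h4
    refine le_trans (ENNReal.ofReal_le_ofReal ?_) h4
    gcongr
    exact min_le_left _ _

/-- Points within a bounded hyperbolic distance of the base points accumulate in the limit
domain. -/
lemma PlanarTendsto.exists_subseq_tendsto_mem {U : ℕ → Set ℂ} {u : ℕ → ℂ} {V : Set ℂ}
    {v : ℂ} (h : PlanarTendsto U u V v) (hV : IsHyperbolicDomain (toSphere V)) (R : ℝ≥0)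
    {z : ℕ → ℂ} (hz : ∀ m, hyperbolicDist (U m) (u m) (z m) ≤ R) :
    ∃ φ : ℕ → ℕ, StrictMono φ ∧ ∃ z₀ ∈ V, Tendsto (fun m => z (φ m)) atTop (𝓝 z₀) := by
  classical
  obtain ⟨L, δ, hL, hδ, hpath⟩ := h.exists_path_bounds hV (R + 1)
  obtain ⟨τ, hτ, hbase⟩ := h.exists_ball_subset
  have hex : ∀ m, ∃ γ : ℝ → ℂ, ContDiff ℝ 1 γ ∧ (∀ t ∈ Icc (0 : ℝ) 1, γ t ∈ U m) ∧ γ 0 = u m ∧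
      γ 1 = z m ∧ hyperbolicLength (U m) γ < ENNReal.ofReal (R + 1) := fun m =>
    exists_path_of_hyperbolicDist_lt ((hz m).trans_lt (by
        rw [← ENNReal.ofReal_coe_nnreal]
        exact (ENNReal.ofReal_lt_ofReal_iff (by positivity)).mpr (by linarith)))
  choose γ hγ hγU hγ0 hγ1 hl using hex
  obtain ⟨G, -, hGf, hG⟩ := finite_cover_balls_of_compact
    (isCompact_closedBall v L) (e := δ / 4) (by positivity)
  -- `P m` records which points of a finite net the `m`-th path visits. Some record `Q` recurs
  -- infinitely often, so the neighbourhood `N` built from `Q` does not depend on `m`. It is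
  -- connected, as a path with record `Q` links its balls, and it lies in those `U m`, as the path
  -- has clearance `δ`. Maximality then gives `N ⊆ V`.
  let P : ℕ → Set ℂ := fun m => {g ∈ G | ∃ t ∈ Icc (0 : ℝ) 1, ‖γ m t - g‖ < δ / 4}
  obtain ⟨Q, hQ⟩ : ∃ Q : Set ℂ, ∃ᶠ m in atTop, P m = Q := by
    by_contra! hcon
    have h1 := (eventually_all_finite (l := atTop) hGf.finite_subsets
      (p := fun Q m => P m ≠ Q)).mpr fun Q _ => (hcon Q)
    obtain ⟨m, hm⟩ := h1.exists
    exact hm (P m) (fun g hg => hg.1) rfl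
  set N : Set ℂ := Metric.ball v τ ∪ ⋃ g ∈ Q, Metric.ball g (δ / 2) with hN
  have hgood : ∃ᶠ m in atTop, P m = Q ∧ (‖u m - v‖ < τ ∧ Metric.ball v (2 * τ) ⊆ U m) ∧
      ∀ t ∈ Icc (0 : ℝ) 1, ‖γ m t - v‖ ≤ L ∧ Metric.ball (γ m t) δ ⊆ U m := by
    refine hQ.and_eventually (hbase.and ?_)
    filter_upwards [hpath] with m hm
    exact hm (γ m) (hγ m) (hγU m) (hγ0 m) (hl m).le
  have hcover : ∀ m, P m = Q → (∀ t ∈ Icc (0 : ℝ) 1, ‖γ m t - v‖ ≤ L) →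
      ∀ t ∈ Icc (0 : ℝ) 1, ∃ g ∈ Q, ‖γ m t - g‖ < δ / 4 := by
    intro m hm hb t ht
    obtain ⟨g, hg, hgt⟩ := mem_iUnion₂.mp (hG (show γ m t ∈ Metric.closedBall v L by
      rw [Metric.mem_closedBall, dist_eq_norm]; exact hb t ht))
    rw [Metric.mem_ball, dist_eq_norm] at hgt
    exact ⟨g, hm ▸ ⟨hg, t, ht, hgt⟩, hgt⟩
  have hNo : IsOpen N := Metric.isOpen_ball.union (isOpen_biUnion fun _ _ => Metric.isOpen_ball)
  have hNc : IsConnected N := by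
    refine ⟨⟨v, Or.inl (Metric.mem_ball_self hτ)⟩, ?_⟩
    obtain ⟨m, hmQ, ⟨hum, -⟩, hmt⟩ := hgood.exists
    have hcurve : γ m '' Icc 0 1 ⊆ ⋃ g ∈ Q, Metric.ball g (δ / 2) := by
      rintro _ ⟨t, ht, rfl⟩
      obtain ⟨g, hg, hgt⟩ := hcover m hmQ (fun t ht => (hmt t ht).1) t ht
      refine mem_iUnion₂.mpr ⟨g, hg, ?_⟩
      rw [Metric.mem_ball, dist_eq_norm]; linarith
    have : N = (Metric.ball v τ ∪ γ m '' Icc 0 1) ∪ ⋃ g ∈ Q, Metric.ball g (δ / 2) := by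
      rw [union_assoc, union_eq_self_of_subset_left hcurve]
    rw [this]
    refine isPreconnected_union_biUnion ?_ (fun g _ => (convex_ball g _).isPreconnected) ?_
    · refine IsPreconnected.union' ⟨u m, ?_, 0, by simp, hγ0 m⟩ (convex_ball v τ).isPreconnected
        (isPreconnected_Icc.image _ (hγ m).continuous.continuousOn)
      rw [Metric.mem_ball, dist_eq_norm]; exact hum
    · intro g hg
      rw [← hmQ] at hg
      obtain ⟨-, t, ht, hgt⟩ := hg
      refine ⟨γ m t, Or.inr ⟨t, ht, rfl⟩, ?_⟩
      rw [Metric.mem_ball, dist_eq_norm]; linarith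
  have hNV : N ⊆ V := by
    refine h.maximal N hNo hNc (Or.inl (Metric.mem_ball_self hτ)) (hgood.mono ?_)
    rintro m ⟨hmQ, ⟨-, hball⟩, hmt⟩
    refine union_subset ((Metric.ball_subset_ball (by linarith)).trans hball)
      (iUnion₂_subset fun g hg => ?_)
    rw [← hmQ] at hg
    obtain ⟨-, t, ht, hgt⟩ := hg
    refine (Metric.ball_subset_ball' ?_).trans (hmt t ht).2
    rw [dist_eq_norm, norm_sub_rev]; linarith
  have hQf : Q.Finite := by
    obtain ⟨m, hm⟩ := hQ.exists
    exact hm ▸ hGf.subset fun g hg => hg.1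
  have hK : IsCompact (⋃ g ∈ Q, Metric.closedBall g (δ / 4)) :=
    hQf.isCompact_biUnion fun g _ => isCompact_closedBall g _
  have hKV : ⋃ g ∈ Q, Metric.closedBall g (δ / 4) ⊆ V := by
    refine Subset.trans (fun x hx => Or.inr ?_) hNV
    obtain ⟨g, hg, hxg⟩ := mem_iUnion₂.mp hx
    exact mem_iUnion₂.mpr ⟨g, hg, Metric.closedBall_subset_ball (by linarith) hxg⟩
  have hzK : ∃ᶠ m in atTop, z m ∈ ⋃ g ∈ Q, Metric.closedBall g (δ / 4) := by
    refine hgood.mono ?_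
    rintro m ⟨hmQ, -, hmt⟩
    obtain ⟨g, hg, hgt⟩ := hcover m hmQ (fun t ht => (hmt t ht).1) 1 (by simp)
    refine mem_iUnion₂.mpr ⟨g, hg, ?_⟩
    rw [Metric.mem_closedBall, dist_eq_norm, ← hγ1 m]
    exact hgt.le
  obtain ⟨z₀, hz₀, φ, hφ, hlim⟩ := hK.tendsto_subseq' hzK
  exact ⟨φ, hφ, z₀, hKV hz₀, hlim⟩

/-! ### Upper bounds for the hyperbolic distance near the limit domain -/

/-- Two points of a connected open set are joined by a `C¹` path. -/
lemma exists_contDiff_path {V : Set ℂ} (hVo : IsOpen V) (hVc : IsConnected V) {v z : ℂ}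
    (hv : v ∈ V) (hz : z ∈ V) : ∃ γ : ℝ → ℂ, ContDiff ℝ 1 γ ∧
      (∀ t ∈ Icc (0 : ℝ) 1, γ t ∈ V) ∧ γ 0 = v ∧ γ 1 = z := by
  refine hVc.isPreconnected.induction₂ (fun v z => ∃ γ : ℝ → ℂ, ContDiff ℝ 1 γ ∧
      (∀ t ∈ Icc (0 : ℝ) 1, γ t ∈ V) ∧ γ 0 = v ∧ γ 1 = z) ?_ ?_ ?_ hv hz
  · intro x hx
    obtain ⟨r, hr, hrV⟩ := Metric.isOpen_iff.mp hVo x hx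
    refine mem_nhdsWithin_of_mem_nhds ?_
    filter_upwards [Metric.ball_mem_nhds x hr] with y hy
    refine ⟨fun t => x + (t : ℂ) * (y - x),
      contDiff_const.add (Complex.ofRealCLM.contDiff.mul contDiff_const), fun t ht => ?_, by simp,
      by simp⟩
    apply hrV
    have := (convex_ball x r).add_smul_sub_mem (Metric.mem_ball_self hr) hy ht
    simpa using this
  · rintro x y z - - - ⟨γ₁, h₁, hU₁, h₁0, h₁1⟩ ⟨γ₂, h₂, hU₂, h₂0, h₂1⟩
    have hσ : ContDiff ℝ 1 Real.smoothTransition := Real.smoothTransition.contDiff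
    -- On the first half of the interval the second summand vanishes, and on the second half `γ₁`
    -- rests at `y`. The smooth transitions make the concatenation `C¹` at the junction.
    refine ⟨fun t => γ₁ (Real.smoothTransition (2 * t)) +
      (γ₂ (Real.smoothTransition (2 * t - 1)) - y), ?_, ?_, ?_, ?_⟩
    · exact (h₁.comp (hσ.comp (contDiff_const.mul contDiff_id))).add
        ((h₂.comp (hσ.comp ((contDiff_const.mul contDiff_id).sub contDiff_const))).sub
          contDiff_const)
    · intro t ht
      have hmem : ∀ x, Real.smoothTransition x ∈ Icc (0 : ℝ) 1 := fun x =>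
        ⟨Real.smoothTransition.nonneg x, Real.smoothTransition.le_one x⟩
      change γ₁ _ + (γ₂ _ - y) ∈ V
      rcases le_total (2 * t) 1 with h | h
      · rw [Real.smoothTransition.zero_of_nonpos (x := 2 * t - 1) (by linarith), h₂0, sub_self,
          add_zero]
        exact hU₁ _ (hmem _)
      · rw [Real.smoothTransition.one_of_one_le h, h₁1, add_sub_cancel]
        exact hU₂ _ (hmem _)
    · simp only [mul_zero, zero_sub]
      rw [Real.smoothTransition.zero_of_nonpos le_rfl,
        Real.smoothTransition.zero_of_nonpos (by norm_num), h₁0, h₂0, sub_self, add_zero]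
    · simp only [mul_one]
      rw [Real.smoothTransition.one_of_one_le (by norm_num),
        Real.smoothTransition.one_of_one_le (by norm_num), h₁1, h₂1, add_sub_cancel]
  · rintro x y - - ⟨γ, h, hU, h0, h1⟩
    refine ⟨fun t => γ (1 - t), h.comp (contDiff_const.sub contDiff_id), fun t ht => hU _ ?_,
      by simpa using h1, by simpa using h0⟩
    exact ⟨by linarith [ht.2], by linarith [ht.1]⟩

/-- Near a point of the limit domain, the hyperbolic distance to the base points is bounded. -/
lemma PlanarTendsto.exists_hyperbolicDist_le {U : ℕ → Set ℂ} {u : ℕ → ℂ} {V : Set ℂ}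
    {v : ℂ} (h : PlanarTendsto U u V v) {z₀ : ℂ} (hz₀ : z₀ ∈ V) :
    ∃ ρ : ℝ, 0 < ρ ∧ ∃ R : ℝ≥0, 0 < R ∧ ∀ᶠ m in atTop, ∀ z ∈ Metric.ball z₀ ρ,
      hyperbolicDist (U m) (u m) z ≤ R := by
  obtain ⟨γ, hγ, hγV, hγ0, hγ1⟩ := exists_contDiff_path h.isOpen h.isConnected h.mem hz₀
  have hΓ : IsCompact (γ '' Icc 0 1) := isCompact_Icc.image hγ.continuous
  obtain ⟨δ, hδ, hδV⟩ := hΓ.exists_cthickening_subset_open h.isOpen (image_subset_iff.mpr hγV)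
  obtain ⟨B, hB⟩ := (isCompact_Icc (a := (0 : ℝ)) (b := 1)).exists_bound_of_continuousOn
    (hγ.continuous_deriv le_rfl).continuousOn
  set r := δ / 2 with hr
  have hr0 : 0 < r := by positivity
  refine ⟨r, hr0, Real.toNNReal (2 / r * (|B| + 2 * r)), by
    rw [Real.toNNReal_pos]; positivity, ?_⟩
  filter_upwards [h.compact_subset _ hΓ.cthickening hδV, Metric.tendsto_nhds.mp h.base r hr0]
    with m hm hum z hz
  rw [dist_eq_norm] at hum
  rw [Metric.mem_ball, dist_eq_norm] at hz
  -- The fixed path `γ` from `v` to `z₀` is corrected by the linear interpolation between `u m - v`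
  -- and `z - z₀`. The correction is smaller than `r = δ / 2`, so `η` keeps clearance `r` inside `U
  -- m`.
  set η : ℝ → ℂ := fun t => γ t + ((u m - v) + (t : ℂ) * ((z - z₀) - (u m - v))) with hη
  have hηd : ∀ t, HasDerivAt η (deriv γ t + ((z - z₀) - (u m - v))) t := fun t => by
    have h1 := (((Complex.ofRealCLM.hasDerivAt (x := t)).mul_const
      ((z - z₀) - (u m - v))).const_add (u m - v))
    simp only [Complex.ofRealCLM_apply, Complex.ofReal_one, one_mul] at h1
    exact ((hγ.differentiable one_ne_zero t).hasDerivAt).add h1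
  have hdist := hyperbolicDist_le_of_path (U := U m) (γ := η) (r := r) (B := |B| + 2 * r)
    (hγ.add (contDiff_const.add (Complex.ofRealCLM.contDiff.mul contDiff_const))) hr0
    (fun t ht => ?_) (fun t ht => ?_)
  · have e0 : η 0 = u m := by simp [hη, hγ0]
    have e1 : η 1 = z := by simp only [hη, hγ1]; push_cast; ring
    rw [e0, e1] at hdist
    exact hdist
  · refine Subset.trans ?_ hm
    refine Subset.trans (Metric.ball_subset_ball' (y := γ t) (ε₂ := δ) ?_)
      ((Metric.ball_subset_thickening (mem_image_of_mem γ ht) δ).trans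
        (Metric.thickening_subset_cthickening _ _))
    have h1 : ‖(u m - v) + (t : ℂ) * ((z - z₀) - (u m - v))‖ < r := by
      have := (convex_ball (0 : ℂ) r).add_smul_sub_mem (x := u m - v) (y := z - z₀) (by simpa using hum)
        (by simpa using hz) ht
      simpa using this
    rw [dist_eq_norm, hη]
    simp only [add_sub_cancel_left]
    linarith
  · rw [(hηd t).deriv]
    refine (norm_add_le _ _).trans ?_
    have h1 := hB t ht
    have h2 := norm_sub_le (z - z₀) (u m - v)
    linarith [le_abs_self B]

/-! ### Arzelà–Ascoli and the two implications -/

/-- A pointwise precompact sequence which is locally eventually equi-Lipschitz on an open set has a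
locally uniformly convergent subsequence. -/
lemma exists_subseq_tendstoLocallyUniformlyOn {E : Type*} [MetricSpace E] [CompleteSpace E]
    {S : Set E} (hS : IsCompact S) {V : Set ℂ} {F : ℕ → ℂ → E}
    (hF : ∀ m z, F m z ∈ S) (hlip : ∀ z₀ ∈ V, ∃ ρ, 0 < ρ ∧ ∃ B : ℝ, ∀ᶠ m in atTop,
      ∀ z ∈ Metric.ball z₀ ρ, ∀ w ∈ Metric.ball z₀ ρ, dist (F m z) (F m w) ≤ B * ‖z - w‖) :
    ∃ φ : ℕ → ℕ, StrictMono φ ∧ ∃ G : ℂ → E, (∀ z, G z ∈ S) ∧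
      TendstoLocallyUniformlyOn (fun m => F (φ m)) G atTop V := by
  classical
  have : CompactSpace S := isCompact_iff_compactSpace.mp hS
  obtain ⟨x, φ, hφ, hx⟩ := CompactSpace.tendsto_subseq
    (fun (m : ℕ) (i : ℕ) => (⟨F m (TopologicalSpace.denseSeq ℂ i), hF m _⟩ : S))
  have hconv : ∀ i, Tendsto (fun m => F (φ m) (TopologicalSpace.denseSeq ℂ i)) atTop (𝓝 (x i)) :=
    fun i => (continuous_subtype_val.tendsto _).comp (tendsto_pi_nhds.mp hx i)
  have hpos : ∀ z₀ ∈ V, ∃ ρ, 0 < ρ ∧ ∃ B : ℝ, 0 < B ∧ ∀ᶠ m in atTop,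
      ∀ z ∈ Metric.ball z₀ ρ, ∀ w ∈ Metric.ball z₀ ρ,
        dist (F (φ m) z) (F (φ m) w) ≤ B * ‖z - w‖ := by
    intro z₀ hz₀
    obtain ⟨ρ, hρ, B, hB⟩ := hlip z₀ hz₀
    refine ⟨ρ, hρ, |B| + 1, by positivity, (hφ.tendsto_atTop.eventually hB).mono ?_⟩
    intro m hm z hz w hw
    refine (hm z hz w hw).trans ?_
    gcongr
    linarith [le_abs_self B]
  have hpt : ∀ z, ∃ y ∈ S, z ∈ V → Tendsto (fun m => F (φ m) z) atTop (𝓝 y) := by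
    intro z
    by_cases hz : z ∈ V
    · obtain ⟨ρ, hρ, B, hB0, hB⟩ := hpos z hz
      have hc : CauchySeq (fun m => F (φ m) z) := by
        rw [Metric.cauchySeq_iff']
        intro ε hε
        obtain ⟨i, hi⟩ := (TopologicalSpace.denseRange_denseSeq ℂ).exists_mem_open
          (Metric.isOpen_ball (x := z) (ε := min ρ (ε / (4 * B))))
          ⟨z, Metric.mem_ball_self (by positivity)⟩
        set d := TopologicalSpace.denseSeq ℂ i with hd
        have hiρ : d ∈ Metric.ball z ρ := Metric.ball_subset_ball (min_le_left _ _) hi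
        have hiε : ‖z - d‖ < ε / (4 * B) := by
          rw [norm_sub_rev, ← dist_eq_norm]
          exact (Metric.mem_ball.mp hi).trans_le (min_le_right _ _)
        have hBd : B * ‖z - d‖ < ε / 4 := by
          calc B * ‖z - d‖ < B * (ε / (4 * B)) := by gcongr
            _ = ε / 4 := by field_simp
        obtain ⟨N, hN⟩ := eventually_atTop.mp
          (hB.and (Metric.tendsto_nhds.mp (hconv i) (ε / 4) (by positivity)))
        refine ⟨N, fun n hn => ?_⟩
        have h1 := (hN n hn).1 z (Metric.mem_ball_self hρ) d hiρ
        have h2 := (hN N le_rfl).1 z (Metric.mem_ball_self hρ) d hiρ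
        rw [dist_comm] at h2
        have h3 := (hN n hn).2
        have h4 := (hN N le_rfl).2
        rw [dist_comm] at h4
        have h5 := dist_triangle4 (F (φ n) z) (F (φ n) d) (x i) (F (φ N) d)
        have h6 := dist_triangle (F (φ n) z) (F (φ N) d) (F (φ N) z)
        linarith
      obtain ⟨y, hy⟩ := cauchySeq_tendsto_of_complete hc
      exact ⟨y, hS.isClosed.mem_of_tendsto hy (Eventually.of_forall fun m => hF _ _), fun _ => hy⟩
    -- Off `V` the limit is given an arbitrary value in `S`, so that `G` takes values in `S`
    -- everywhere.
    · exact ⟨F 0 z, hF 0 z, fun h => absurd h hz⟩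
  choose G hGS hG using hpt
  refine ⟨φ, hφ, G, hGS, ?_⟩
  rw [Metric.tendstoLocallyUniformlyOn_iff]
  intro ε hε z₀ hz₀
  obtain ⟨ρ, hρ, B, hB0, hB⟩ := hpos z₀ hz₀
  refine ⟨Metric.ball z₀ (min ρ (ε / (4 * B))) ∩ V,
    inter_mem (mem_nhdsWithin_of_mem_nhds (Metric.ball_mem_nhds _ (by positivity)))
      self_mem_nhdsWithin, ?_⟩
  have hz₀ρ := Metric.mem_ball_self (x := z₀) hρ
  have hBd : ∀ z ∈ Metric.ball z₀ (min ρ (ε / (4 * B))), B * ‖z - z₀‖ < ε / 4 := by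
    intro z hz
    have hz' : ‖z - z₀‖ < ε / (4 * B) := by
      rw [← dist_eq_norm]
      exact (Metric.mem_ball.mp hz).trans_le (min_le_right _ _)
    calc B * ‖z - z₀‖ < B * (ε / (4 * B)) := by gcongr
      _ = ε / 4 := by field_simp
  filter_upwards [hB, Metric.tendsto_nhds.mp (hG z₀ hz₀) (ε / 4) (by positivity)]
    with m hm hm0 z hz
  have hzρ : z ∈ Metric.ball z₀ ρ := Metric.ball_subset_ball (min_le_left _ _) hz.1
  have h1 := hm z hzρ z₀ hz₀ρ
  have h2 : dist (G z) (G z₀) ≤ B * ‖z - z₀‖ :=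
    le_of_tendsto ((hG z hz.2).dist (hG z₀ hz₀)) (hB.mono fun n hn => hn z hzρ z₀ hz₀ρ)
  have h3 := hBd z hz.1
  have h4 := dist_triangle4 (G z) (G z₀) (F (φ m) z₀) (F (φ m) z)
  rw [dist_comm (G z₀), dist_comm (F (φ m) z₀) (F (φ m) z)] at h4
  linarith

/-- A neighbourhood of a point of the limit lies in a fixed hyperbolic ball about the base points,
and there the hyperbolic distance is at most a multiple of the euclidean one. The equicontinuity
constant for that ball thus becomes a local euclidean Lipschitz constant. -/
theorem isNormalFamilyOn_of_isEquicontinuousFamilyOn {A : Type*} {U : A → Set ℂ} {u : A → ℂ}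
    {f : A → ℂ → OnePoint ℂ} (hf : ∀ a, SphereAnalyticOn (f a) (U a))
    (h : IsEquicontinuousFamilyOn U u f) : IsNormalFamilyOn U u f := by
  intro s V v hs hV
  obtain ⟨v', -, -, hp⟩ := hs.planar hV
  set W := {z : ℂ | (z : OnePoint ℂ) ∈ V} with hW
  obtain ⟨φ, hφ, G, hGS, hG⟩ := exists_subseq_tendstoLocallyUniformlyOn
    (V := W) (F := fun m z => sphereEmb (f (s m) z)) isCompact_range_sphereEmb
    (fun m z => mem_range_self _) (fun z₀ hz₀ => by
      obtain ⟨ρ, hρ, R, hR0, hR⟩ := hp.exists_hyperbolicDist_le hz₀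
      obtain ⟨r, hr, hrW⟩ := Metric.isOpen_iff.mp hp.isOpen z₀ hz₀
      obtain ⟨M, hM⟩ := h R hR0
      -- Points `z`, `w` within `r'` of `z₀` are at most `2 * r'` apart, and the ball of radius `4 *
      -- r'` about `z` required by `hyperbolicDist_le_of_ball` lies in the closed ball of radius `6
      -- * r'` about `z₀`.
      set r' := r / 8 with hr'
      have hr'0 : 0 < r' := by positivity
      refine ⟨min ρ r', by positivity, M * (2 / (2 * r')), ?_⟩
      filter_upwards [hR, hp.compact_subset (Metric.closedBall z₀ (6 * r'))
        (isCompact_closedBall _ _) ((Metric.closedBall_subset_ball (by linarith)).trans hrW)]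
        with m hmR hmU z hz w hw
      have hball : ∀ z ∈ Metric.ball z₀ (min ρ r'), z ∈ Metric.ball z₀ ρ ∧ ‖z - z₀‖ < r' ∧
          Metric.ball z (2 * (2 * r')) ⊆ U (s m) := by
        intro z hz
        have h1 : dist z z₀ < r' := (Metric.mem_ball.mp hz).trans_le (min_le_right _ _)
        refine ⟨Metric.ball_subset_ball (min_le_left _ _) hz, by rwa [← dist_eq_norm], ?_⟩
        refine (Metric.ball_subset_closedBall.trans ?_).trans hmU
        exact Metric.closedBall_subset_closedBall' (by linarith)
      obtain ⟨hzρ, hzr, hzU⟩ := hball z hz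
      obtain ⟨hwρ, hwr, hwU⟩ := hball w hw
      have hwz : ‖w - z‖ ≤ 2 * r' := by
        have := norm_sub_le_norm_sub_add_norm_sub w z₀ z
        rw [norm_sub_rev z₀ z] at this
        linarith
      have h1 := hM (s m) z (hzU (Metric.mem_ball_self (by positivity))) w
        (hwU (Metric.mem_ball_self (by positivity))) (hmR z hzρ) (hmR w hwρ)
      have h2 := hyperbolicDist_le_of_ball (U := U (s m)) (by positivity) hzU hwz
      have h3 : ENNReal.ofReal (sphericalDist (f (s m) z) (f (s m) w)) ≤
          ENNReal.ofReal (M * (2 / (2 * r') * ‖w - z‖)) := by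
        rw [ENNReal.ofReal_mul M.coe_nonneg, ENNReal.ofReal_coe_nnreal]
        exact h1.trans (by gcongr)
      rw [ENNReal.ofReal_le_ofReal_iff (by positivity)] at h3
      refine (dist_sphereEmb_le_sphericalDist _ _).trans (h3.trans (le_of_eq ?_))
      rw [norm_sub_rev]; ring)
  -- The limit takes values in the embedded sphere, so it lifts to a map into `OnePoint ℂ`.
  choose g hg using hGS
  have hGg : G = fun z => sphereEmb (g z) := funext fun z => (hg z).symm
  rw [hGg] at hG
  have hunif := (tendstoLocallyUniformlyOn_iff_forall_isCompact hp.isOpen).mp hG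
  refine ⟨φ, hφ, g, fun z₀ hz₀ => ?_, fun K hK hKW ε hε => ?_⟩
  · obtain ⟨r, hr, hrW⟩ := Metric.isOpen_iff.mp hp.isOpen z₀ hz₀
    have hsub : Metric.closedBall z₀ (r / 2) ⊆ W :=
      (Metric.closedBall_subset_ball (by linarith)).trans hrW
    refine sphereAnalyticAt_of_tendstoUniformlyOn (f := fun m => f (s (φ m))) (half_pos hr) ?_
      ((hunif _ hsub (isCompact_closedBall _ _)).mono Metric.ball_subset_closedBall)
    filter_upwards [(hp.comp hφ).compact_subset _ (isCompact_closedBall _ _) hsub] with m hm z hz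
    exact hf _ z (hm (Metric.ball_subset_closedBall hz))
  · obtain ⟨m₀, hm₀⟩ := eventually_atTop.mp
      (Metric.tendstoUniformlyOn_iff.mp (hunif K hKW hK) (ε / 3) (by positivity))
    refine ⟨m₀, fun m hm z hz => ?_⟩
    have h1 := hm₀ m hm z hz
    rw [dist_comm] at h1
    have h2 := sphericalDist_le_three_mul (f (s (φ m)) z) (g z)
    linarith

theorem isEquicontinuousFamilyOn_of_isNormalFamilyOn {A : Type*} {U : A → Set ℂ} {u : A → ℂ}
    (hU : IsNondegenerateFamily U u) {f : A → ℂ → OnePoint ℂ}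
    (hf : ∀ a, SphereAnalyticOn (f a) (U a)) (h : IsNormalFamilyOn U u f) :
    IsEquicontinuousFamilyOn U u f := by
  intro R hR
  by_contra! hcon
  choose s z hzU w hwU hz hw hlt using fun n : ℕ => hcon (n : ℝ≥0)
  -- a convergent subsequence of the domains, then of the functions, then of the points
  obtain ⟨φ₁, hφ₁, V, v, hp, hcar, hhyp⟩ := hU.exists_subseq_planarTendsto s
  have hne : toSphere V ≠ {(v : OnePoint ℂ)} := fun h =>
    not_isOpen_singleton_sphere _ (h ▸ hhyp.1)
  have hVset : {z : ℂ | (z : OnePoint ℂ) ∈ toSphere V} = V := by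
    ext z; exact coe_mem_toSphere
  obtain ⟨φ₂, hφ₂, g, -, hgu⟩ := h _ _ _ hcar hne
  rw [hVset] at hgu
  have hp₂ := hp.comp hφ₂
  obtain ⟨φ₃, hφ₃, z₀, hz₀, hzlim⟩ := hp₂.exists_subseq_tendsto_mem hhyp R
    (z := fun m => z (φ₁ (φ₂ m))) (fun m => hz _)
  have hp₃ := hp₂.comp hφ₃
  obtain ⟨φ₄, hφ₄, w₀, hw₀, hwlim⟩ := hp₃.exists_subseq_tendsto_mem hhyp R
    (z := fun m => w (φ₁ (φ₂ (φ₃ m)))) (fun m => hw _)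
  have hp₄ := hp₃.comp hφ₄
  set φ : ℕ → ℕ := fun m => φ₁ (φ₂ (φ₃ (φ₄ m))) with hφdef
  have hφ : Tendsto φ atTop atTop :=
    (hφ₁.comp (hφ₂.comp (hφ₃.comp hφ₄))).tendsto_atTop
  have hzl : Tendsto (fun m => z (φ m)) atTop (𝓝 z₀) := hzlim.comp hφ₄.tendsto_atTop
  obtain ⟨c, hc, hlow⟩ := hp₄.exists_mul_dist_le_hyperbolicDist hhyp R
  -- it suffices to bound the difference quotients
  suffices hsuff : ∃ B : ℝ, ∀ᶠ m in atTop,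
      dist (sphereEmb (f (s (φ m)) (z (φ m)))) (sphereEmb (f (s (φ m)) (w (φ m)))) ≤
        B * ‖z (φ m) - w (φ m)‖ by
    obtain ⟨B, hB⟩ := hsuff
    obtain ⟨m, hm1, hm2, hm3⟩ := (hB.and (hlow.and
      (hφ.eventually (eventually_ge_atTop ⌈3 * |B| / c⌉₊)))).exists
    have h1 := sphericalDist_le_three_mul (f (s (φ m)) (z (φ m))) (f (s (φ m)) (w (φ m)))
    have h2 := hm2 (z (φ m)) (w (φ m)) (hz _) (hw _)
    have h3 : 3 * |B| ≤ φ m * c := by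
      rw [← div_le_iff₀ hc]
      exact (Nat.le_ceil _).trans (by exact_mod_cast hm3)
    have h4 : sphericalDist (f (s (φ m)) (z (φ m))) (f (s (φ m)) (w (φ m))) ≤
        φ m * (c * ‖z (φ m) - w (φ m)‖) := by
      calc _ ≤ 3 * (B * ‖z (φ m) - w (φ m)‖) := h1.trans (by linarith)
        _ ≤ 3 * (|B| * ‖z (φ m) - w (φ m)‖) := by gcongr; exact le_abs_self B
        _ = 3 * |B| * ‖z (φ m) - w (φ m)‖ := by ring
        _ ≤ φ m * c * ‖z (φ m) - w (φ m)‖ := by gcongr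
        _ = _ := by ring
    refine (hlt (φ m)).not_ge ((ENNReal.ofReal_le_ofReal h4).trans ?_)
    rw [ENNReal.ofReal_mul (by positivity), ENNReal.ofReal_natCast]
    push_cast
    gcongr
  -- If the limit points agree, both sequences end in a ball where the maps are equi-Lipschitz. If
  -- they differ, the denominators stay away from `0` and the numerators are bounded by the diameter
  -- of the sphere.
  rcases eq_or_ne z₀ w₀ with rfl | hzw
  · obtain ⟨r, hr, hrV⟩ := Metric.isOpen_iff.mp hp.isOpen z₀ hz₀
    have hsub : Metric.closedBall z₀ (r / 2) ⊆ V :=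
      (Metric.closedBall_subset_ball (by linarith)).trans hrV
    have hunif : TendstoUniformlyOn (fun m z => sphereEmb (f (s (φ m)) z))
        (fun z => sphereEmb (g z)) atTop (Metric.ball z₀ (r / 2)) := by
      rw [Metric.tendstoUniformlyOn_iff]
      intro ε hε
      obtain ⟨m₀, hm₀⟩ := hgu _ (isCompact_closedBall _ _) hsub ε hε
      filter_upwards [(hφ₃.comp hφ₄).tendsto_atTop.eventually (eventually_ge_atTop m₀)]
        with m hm x hx
      rw [dist_comm]
      exact (dist_sphereEmb_le_sphericalDist _ _).trans_lt
        (hm₀ _ hm x (Metric.ball_subset_closedBall hx))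
    obtain ⟨ρ, hρ, B, hB⟩ := exists_lipschitz_of_tendstoUniformlyOn
      (f := fun m => f (s (φ m))) (half_pos hr) (by
        filter_upwards [hp₄.compact_subset _ (isCompact_closedBall _ _) hsub] with m hm x hx
        exact hf _ x (hm (Metric.ball_subset_closedBall hx))) hunif
    refine ⟨B, ?_⟩
    filter_upwards [hB, hzl.eventually (Metric.ball_mem_nhds z₀ hρ),
      hwlim.eventually (Metric.ball_mem_nhds z₀ hρ)] with m hm hmz hmw
    exact hm _ hmz _ hmw
  · have hd : 0 < ‖z₀ - w₀‖ := norm_pos_iff.mpr (sub_ne_zero.mpr hzw)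
    obtain ⟨D, hD⟩ := Metric.isBounded_iff.mp isCompact_range_sphereEmb.isBounded
    refine ⟨|D| / (‖z₀ - w₀‖ / 2), ?_⟩
    filter_upwards [(hzl.sub hwlim).norm.eventually (lt_mem_nhds (half_lt_self hd))] with m hm
    have h1 := hD (mem_range_self (f (s (φ m)) (z (φ m)))) (mem_range_self (f (s (φ m)) (w (φ m))))
    calc _ ≤ |D| := h1.trans (le_abs_self D)
      _ = |D| / (‖z₀ - w₀‖ / 2) * (‖z₀ - w₀‖ / 2) := by field_simp
      _ ≤ _ := by gcongr

end

theorem proposition4p1 {A : Type*} (U : A → Set ℂ) (u : A → ℂ) (hU : IsNondegenerateFamily U u)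
    (f : A → ℂ → OnePoint ℂ) (hf : ∀ a, SphereAnalyticOn (f a) (U a)) :
    IsNormalFamilyOn U u f ↔ IsEquicontinuousFamilyOn U u f :=
  ⟨isEquicontinuousFamilyOn_of_isNormalFamilyOn hU hf,
    isNormalFamilyOn_of_isEquicontinuousFamilyOn hf⟩
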